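/- Let $k\in\{2,3,\dots,\infty\}$ (with $\infty-1=\infty-2=\infty$). Let $I\subset\mathbb R$ be an open interval, $D_0\subset\mathbb R^3$ open, and let $\chi:I\times D_0\to\mathbb R^3$ be a motion of a fluid: $\chi$ is of class $C^k$ and, for each $t\in I$, $\chi_t=\chi(t,\cdot)$ is a diffeomorphism of $D_0$ onto $D_t=\chi_t(D_0)$, with invertible deformation gradient $F=\partial\chi/\partial X$. Let $\mathbf V$ be its Eulerian velocity field, $d/dt$ the material derivative (time derivative along the trajectories $t\mapsto\chi(t,X)$) and $\mathbf\Gamma=d\mathbf V/dt$ the acceleration. The convective derivative $d_c$ is the time derivative taken in the reference space: $(d_cL)F=\frac{d}{dt}(LF)$ for a covector field $L$ and $F^{-1}(d_c\mathbf U)=\frac{d}{dt}(F^{-1}\mathbf U)$ for a vector field $\mathbf U$; a field is convected by the flow if its convective derivative vanishes. Let $\rho>0$ and $T,g,\Omega,u$ be scalar fields on $\{(t,x):t\in I,\ x\in D_t\}$, with $T$ of class $C^k$ and $g,\Omega,u$ of class $C^{k-1}$. Consider the flow system $$\text{(S)}\qquad \frac{d\rho}{dt}+\rho\,\mathrm{div}\,\mathbf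 V=0,\qquad \frac{dT}{dt}=0,\qquad \mathbf\Gamma=u\,\mathrm{grad}\,T-\mathrm{grad}(g+\Omega),$$ the system $$\text{(P)}\qquad \mathbf V=\mathrm{grad}\,\varphi+\psi\,\mathrm{grad}\,T+\mathbf C,\quad \frac{dT}{dt}=0,\quad \frac{d\varphi}{dt}=\tfrac12\mathbf V^2-g-\Omega,\quad \frac{d\psi}{dt}=u,\quad d_c\mathbf C^{*}=0,$$ where $\mathbf C^*$ is the covector field associated with $\mathbf C$, and the system of potential equations, in which the velocity is given by the five potentials $\varphi,\psi,T,\gamma,\nu$, $$\text{(E)}\qquad \mathbf V=\mathrm{grad}\,\varphi+\psi\,\mathrm{grad}\,T+\gamma\,\mathrm{grad}\,\nu,\quad \frac{dT}{dt}=\frac{d\gamma}{dt}=\frac{d\nu}{dt}=0,\quad \frac{d\varphi}{dt}=\tfrac12\mathbf V^2-g-\Omega,\quad \frac{d\psi}{dt}=u .$$ 1. (S) holds if and only if the equation of continuity holds and there are fields $\varphi,\psi,\mathbf C$ of class $C^{k-1}$ satisfying (P) (on the whole flow domain). 2. If the equation of continuity and (P) hold with $\mathbf C$ of class $C^1$,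 then $\mathbf U=\frac1\rho\,\mathrm{rot}\,\mathbf C$ is convected by the flow: $d_c\mathbf U=0$, that is, $\frac{d\mathbf U}{dt}=\frac{\partial\mathbf V}{\partial x}\mathbf U$. 3. If (S) holds, then every particle $X_0\in D_0$ such that $\mathrm{grad}\,T\neq0$ at $(t_0,\chi(t_0,X_0))$ for some $t_0\in I$ has an open neighbourhood $S\subset D_0$ such that, on $\{(t,x):t\in I,\ x\in\chi_t(S)\}$, (E) holds for some $\varphi$ of class $C^{k-1}$, $\psi,\gamma$ of class $C^{k-2}$ and $\nu$ of class $C^{k}$, with $\mathrm{grad}\,T$ and $\mathrm{grad}\,\nu$ linearly independent everywhere. 4. Conversely, if the equation of continuity holds and every particle has an open neighbourhood $S\subset D_0$ on which (in the sense of 3) (E) holds for some $\varphi,\nu$ of class $C^1$ and continuous $\psi,\gamma$, then (S) holds. -/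

import Mathlib

open scoped Gradient

noncomputable section

namespace Fluid

/-- Physical (and reference) space: three-dimensional Euclidean space. -/
abbrev Space : Type := EuclideanSpace ℝ (Fin 3)

/-- The motion of a continuous medium, of class `C^(m+2)`: on an open time interval `time`, the
medium occupying the open reference domain `ref` is carried to `pos t '' ref` by a time-dependent
diffeomorphism `pos t`. -/
structure Motion (m : ℕ∞) where
  time : Set ℝ
  ref : Set Space
  pos : ℝ → Space → Space
  isOpen_time : IsOpen time
  ordConnected_time : time.OrdConnected
  isOpen_ref : IsOpen ref
  contDiffOn_pos :
    ContDiffOn ℝ ((m : WithTop ℕ∞) + 2) (fun p : ℝ × Space => pos p.1 p.2) (time ×ˢ ref)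
  injOn_pos : ∀ t ∈ time, Set.InjOn (pos t) ref
  isInvertible_fderiv_pos : ∀ t ∈ time, ∀ X ∈ ref, (fderiv ℝ (pos t) X).IsInvertible

/-- Divergence of a vector field. -/
def div (A : Space → Space) (x : Space) : ℝ :=
  LinearMap.trace ℝ Space (fderiv ℝ A x).toLinearMap

/-- `partialD A x i j` is the partial derivative `∂ A_j / ∂ x_i`. -/
def partialD (A : Space → Space) (x : Space) (i j : Fin 3) : ℝ :=
  (fderiv ℝ A x (EuclideanSpace.single i 1)) j

/-- Rotational (curl) of a vector field. -/
def rot (A : Space → Space) (x : Space) : Space :=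
  !₂[partialD A x 1 2 - partialD A x 2 1,
     partialD A x 2 0 - partialD A x 0 2,
     partialD A x 0 1 - partialD A x 1 0]

namespace Motion

variable {m : ℕ∞} {W : Type*} [NormedAddCommGroup W] [NormedSpace ℝ W]

/-- The space-time region swept by the set `S` of particles. -/
def region (M : Motion m) (S : Set Space) : Set (ℝ × Space) :=
  {p | p.1 ∈ M.time ∧ p.2 ∈ M.pos p.1 '' S}

/-- A space-time field is of class `C^n` on the region swept by the set `S` of particles. -/
def IsOfClass (M : Motion m) (S : Set Space) (n : WithTop ℕ∞) (f : ℝ → Space → W) : Prop :=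
  ContDiffOn ℝ n (fun p : ℝ × Space => f p.1 p.2) (M.region S)

/-- The particle (reference position) that is at `x` at time `t`. -/
def label (M : Motion m) (t : ℝ) (x : Space) : Space :=
  Function.invFunOn (M.pos t) M.ref x

/-- The (Eulerian) velocity field. -/
def velocity (M : Motion m) (t : ℝ) (x : Space) : Space :=
  deriv (fun τ => M.pos τ (M.label t x)) t

/-- The deformation gradient. -/
def defGrad (M : Motion m) (t : ℝ) (X : Space) : Space →L[ℝ] Space :=
  fderiv ℝ (M.pos t) X

/-- `df/dt = f'` for the particles in `S`, where `d/dt` is the material derivative, the derivative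
with respect to time when one follows the particle. -/
def HasMaterialDeriv (M : Motion m) (S : Set Space) (f f' : ℝ → Space → W) : Prop :=
  ∀ t ∈ M.time, ∀ X ∈ S, HasDerivAt (fun τ => f τ (M.pos τ X)) (f' t (M.pos t X)) t

/-- `d_c L = L'` for a field of covectors: the derivative in time of the image `L F` of `L` in the
reference space is the image `L' F` of `L'`. -/
def HasConvectiveDerivCovector (M : Motion m) (S : Set Space)
    (L L' : ℝ → Space → (Space →L[ℝ] ℝ)) : Prop :=
  ∀ t ∈ M.time, ∀ X ∈ S,
    HasDerivAt (fun τ => (L τ (M.pos τ X)).comp (M.defGrad τ X))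
      ((L' t (M.pos t X)).comp (M.defGrad t X)) t

/-- `d_c U = U'` for a field of vectors: the derivative in time of the image `F⁻¹ U` of `U` in the
reference space is the image `F⁻¹ U'` of `U'`. -/
def HasConvectiveDerivVector (M : Motion m) (S : Set Space) (U U' : ℝ → Space → Space) : Prop :=
  ∀ t ∈ M.time, ∀ X ∈ S,
    HasDerivAt (fun τ => (M.defGrad τ X).inverse (U τ (M.pos τ X)))
      ((M.defGrad t X).inverse (U' t (M.pos t X))) t

/-- Equation of continuity `dρ/dt + ρ div V = 0`. -/
def Continuity (M : Motion m) (S : Set Space) (ρ : ℝ → Space → ℝ) : Prop :=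
  M.HasMaterialDeriv S ρ (fun t x => -(ρ t x * div (M.velocity t) x))

/-- Equation of motion `Γ = u grad T - grad (g + Ω)`, with `Γ = dV/dt` the acceleration. -/
def MotionEquation (M : Motion m) (S : Set Space) (T g Ω u : ℝ → Space → ℝ) : Prop :=
  M.HasMaterialDeriv S M.velocity
    (fun t x => u t x • ∇ (T t) x - ∇ (fun y => g t y + Ω t y) x)

/-- The system of the equation of continuity, `dT/dt = 0` and the equation of motion. -/
structure FlowSystem (M : Motion m) (S : Set Space) (ρ T g Ω u : ℝ → Space → ℝ) : Prop where
  continuity : M.Continuity S ρ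
  temperature : M.HasMaterialDeriv S T (fun _ _ => 0)
  motion : M.MotionEquation S T g Ω u

/-- `V = grad φ + ψ grad T + C`, `dT/dt = 0`, `dφ/dt = V² / 2 - g - Ω`, `dψ/dt = u`,
`d_c C* = 0`, where `C*` is the covector of `C`. -/
structure PotentialSystem (M : Motion m) (S : Set Space) (T g Ω u φ ψ : ℝ → Space → ℝ)
    (C : ℝ → Space → Space) : Prop where
  velocity_eq : ∀ t ∈ M.time, ∀ x ∈ M.pos t '' S,
    M.velocity t x = ∇ (φ t) x + ψ t x • ∇ (T t) x + C t x
  deriv_T : M.HasMaterialDeriv S T (fun _ _ => 0)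
  deriv_phi : M.HasMaterialDeriv S φ
    (fun t x => (1 / 2) * ‖M.velocity t x‖ ^ 2 - g t x - Ω t x)
  deriv_psi : M.HasMaterialDeriv S ψ u
  convected_C : M.HasConvectiveDerivCovector S (fun t x => innerSL ℝ (C t x)) (fun _ _ => 0)

/-- `V = grad φ + ψ grad T + γ grad ν`, `dT/dt = dγ/dt = dν/dt = 0`,
`dφ/dt = V² / 2 - g - Ω`, `dψ/dt = u`. -/
structure ClebschSystem (M : Motion m) (S : Set Space)
    (T g Ω u φ ψ γ ν : ℝ → Space → ℝ) : Prop where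
  velocity_eq : ∀ t ∈ M.time, ∀ x ∈ M.pos t '' S,
    M.velocity t x = ∇ (φ t) x + ψ t x • ∇ (T t) x + γ t x • ∇ (ν t) x
  deriv_T : M.HasMaterialDeriv S T (fun _ _ => 0)
  deriv_phi : M.HasMaterialDeriv S φ
    (fun t x => (1 / 2) * ‖M.velocity t x‖ ^ 2 - g t x - Ω t x)
  deriv_psi : M.HasMaterialDeriv S ψ u
  deriv_gamma : M.HasMaterialDeriv S γ (fun _ _ => 0)
  deriv_nu : M.HasMaterialDeriv S ν (fun _ _ => 0)

end Motion

end Fluid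

end

/-! ### Smooth dependence of integrals on parameters and endpoints. -/

section ParametricIntegral

open Set Filter Topology MeasureTheory intervalIntegral

/-! The proof works in the reference space. Let `P` be the covector of the velocity transported
there (`momentum`), `L = V²/2 - g - Ω` and `θ` the temperature seen from the particles. Since
`dF/dt` is the gradient of the velocity in the reference variable, `V* dF/dt = d(V²/2)`, and the
equation of motion becomes `∂P/∂t = dL + u dθ` (`motionEquation_iff`). Conservation of temperature
makes `dθ` independent of time. With `Φ` and `Ψ` the primitives in time of `L` and `u` vanishing at
a time `a`, the covector `P - dΦ - Ψ dθ` is therefore constant along each trajectory, equal to `P`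
at time `a` (`momentum_eq_of_motionEquation`). Carrying this constant covector forward by `F⁻¹`
gives the convected field `C*`. Conversely, differentiating `P = dφ + ψ dθ + const` in time gives
back the equation of motion (`PotentialSystem.motionEquation`).

For the five potentials, only the fixed covector `P` at time `a` has to be decomposed as `dφ₀ + ψ₀
dθ + γ₀ dν₀` near a regular point of `θ` (`exists_local_potentials`); as `dθ` is frozen, the
decomposition persists for all times. The converse reduces to the previous one with `C = γ grad ν`.

For the vorticity, `C* F` is constant in time, hence so is its exterior derivative, which is the
pullback of that of `C*`. In terms of axial vectors, `F` sends the rotational in the reference space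
to `det F • rot C` (`map_axialVector_of_pullback`). As `ρ det F` is conserved, `(1/ρ) rot C = F k`
with `k` fixed on each trajectory. -/

theorem eventually_norm_le_of_continuousAt {E W : Type*} [NormedAddCommGroup E]
    [NormedAddCommGroup W] {f : ℝ → E → W} {K : Set ℝ} (hK : IsCompact K) {p : E}
    (hf : ∀ s ∈ K, ContinuousAt (fun q : ℝ × E => f q.1 q.2) (s, p)) :
    ∃ c : ℝ, ∀ᶠ x in 𝓝 p, ∀ s ∈ K, ‖f s x‖ ≤ c := by
  have hc : ContinuousOn (fun s => f s p) K := fun s hs =>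
    (ContinuousAt.comp (f := fun s : ℝ => (s, p)) (g := fun q : ℝ × E => f q.1 q.2)
      (hf s hs) (by fun_prop)).continuousWithinAt
  obtain ⟨c, hc⟩ := hK.exists_bound_of_continuousOn hc
  -- Adding 1 makes the bound strict at `p`, so that it persists nearby; compactness of `K` gives
  -- one neighbourhood for all `s`.
  refine ⟨c + 1, hK.eventually_forall_of_forall_eventually fun s hs => ?_⟩
  have h1 : ContinuousAt (fun q : E × ℝ => ‖f q.2 q.1‖) (p, s) :=
    (ContinuousAt.comp (f := fun q : E × ℝ => (q.2, q.1)) (g := fun q : ℝ × E => f q.1 q.2)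
      (x := (p, s)) (hf s hs) (by fun_prop)).norm
  have h2 : ‖f s p‖ < c + 1 := (hc s hs).trans_lt (lt_add_one c)
  exact (h1.eventually_lt continuousAt_const h2).mono fun q hq => hq.le

theorem continuousAt_intervalIntegral_of_eventually {E W : Type*} [NormedAddCommGroup E]
    [NormedAddCommGroup W] [NormedSpace ℝ W] {f : ℝ → E → W} {a b : ℝ} {p : E}
    (hf : ∀ᶠ x in 𝓝 p, ∀ s ∈ uIcc a b, ContinuousAt (fun q : ℝ × E => f q.1 q.2) (s, x)) :
    ContinuousAt (fun x => ∫ s in a..b, f s x) p := by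
  obtain ⟨c, hc⟩ := eventually_norm_le_of_continuousAt isCompact_uIcc hf.self_of_nhds
  refine continuousAt_of_dominated_interval (bound := fun _ => c) ?_ ?_ ?_ ?_
  · filter_upwards [hf] with x hx
    exact (ContinuousOn.mono (fun s hs => (ContinuousAt.comp (f := fun s : ℝ => (s, x))
      (g := fun q : ℝ × E => f q.1 q.2) (hx s hs) (by fun_prop)).continuousWithinAt)
      uIoc_subset_uIcc).aestronglyMeasurable measurableSet_uIoc
  · filter_upwards [hc] with x hx
    exact Eventually.of_forall fun s hs => hx s (uIoc_subset_uIcc hs)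
  · exact intervalIntegrable_const
  · exact Eventually.of_forall fun s hs => ContinuousAt.comp (f := fun x : E => (s, x))
      (g := fun q : ℝ × E => f q.1 q.2) (hf.self_of_nhds s (uIoc_subset_uIcc hs)) (by fun_prop)

variable {E W : Type} [NormedAddCommGroup E] [NormedSpace ℝ E] [NormedAddCommGroup W]
  [NormedSpace ℝ W]

theorem ContDiffAt.fderiv_snd {n : WithTop ℕ∞} {f : ℝ → E → W} {s : ℝ} {p : E}
    (hf : ContDiffAt ℝ (n + 1) (fun q : ℝ × E => f q.1 q.2) (s, p)) :
    ContDiffAt ℝ n (fun q : ℝ × E => fderiv ℝ (f q.1) q.2) (s, p) := by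
  have h : ContDiffAt ℝ (n + 1) (Function.uncurry fun (q : ℝ × E) (y : E) => f q.1 y) ((s, p), p) :=
    ContDiffAt.comp (f := fun r : (ℝ × E) × E => (r.1.1, r.2)) ((s, p), p)
      (g := fun q : ℝ × E => f q.1 q.2) hf (by fun_prop)
  exact ContDiffAt.fderiv h contDiffAt_snd le_rfl

theorem eventually_forall_contDiffAt {f : ℝ → E → W} {K : Set ℝ} (hK : IsCompact K) {p : E}
    {n : ℕ} (hf : ∀ s ∈ K, ContDiffAt ℝ n (fun q : ℝ × E => f q.1 q.2) (s, p)) :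
    ∀ᶠ x in 𝓝 p, ∀ s ∈ K, ContDiffAt ℝ n (fun q : ℝ × E => f q.1 q.2) (s, x) := by
  refine hK.eventually_forall_of_forall_eventually fun s hs => ?_
  have := (hf s hs).eventually (by simp)
  have h : Tendsto (fun q : E × ℝ => (q.2, q.1)) (𝓝 (p, s)) (𝓝 (s, p)) :=
    (continuous_snd.prodMk continuous_fst).tendsto _
  exact h.eventually this

theorem ContDiffAt.continuousAt_fst {f : ℝ → E → W} {n : WithTop ℕ∞} {s : ℝ} {p : E}
    (hf : ContDiffAt ℝ n (fun q : ℝ × E => f q.1 q.2) (s, p)) :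
    ContinuousAt (fun s => f s p) s :=
  ContinuousAt.comp (f := fun s : ℝ => (s, p)) (g := fun q : ℝ × E => f q.1 q.2)
      hf.continuousAt (by fun_prop)

theorem continuousOn_fst_of_contDiffAt {f : ℝ → E → W} {n : WithTop ℕ∞} {K : Set ℝ} {p : E}
    (hf : ∀ s ∈ K, ContDiffAt ℝ n (fun q : ℝ × E => f q.1 q.2) (s, p)) :
    ContinuousOn (fun s => f s p) K :=
  fun s hs => (hf s hs).continuousAt_fst.continuousWithinAt

theorem hasFDerivAt_intervalIntegral_of_contDiffAt {f : ℝ → E → W} {a b : ℝ} {p : E}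
    (hf : ∀ s ∈ uIcc a b, ContDiffAt ℝ 1 (fun q : ℝ × E => f q.1 q.2) (s, p)) :
    HasFDerivAt (fun x => ∫ s in a..b, f s x) (∫ s in a..b, fderiv ℝ (f s) p) p := by
  have hf' : ∀ s ∈ uIcc a b, ContDiffAt ℝ 0 (fun q : ℝ × E => fderiv ℝ (f q.1) q.2) (s, p) :=
    fun s hs => ContDiffAt.fderiv_snd (by simpa using hf s hs)
  have hev := eventually_forall_contDiffAt (n := 1) isCompact_uIcc (by simpa using hf)
  obtain ⟨c, hc⟩ := eventually_norm_le_of_continuousAt (f := fun s x => fderiv ℝ (f s) x)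
    isCompact_uIcc fun s hs => (hf' s hs).continuousAt
  refine hasFDerivAt_integral_of_dominated_of_fderiv_le (hev.and hc)
    (F := fun x s => f s x) (F' := fun x s => fderiv ℝ (f s) x) (bound := fun _ => c)
    ?_ ?_ ?_ ?_ ?_ ?_
  · filter_upwards [hev] with x hx
    exact ((continuousOn_fst_of_contDiffAt hx).mono uIoc_subset_uIcc).aestronglyMeasurable
      measurableSet_uIoc
  · exact (continuousOn_fst_of_contDiffAt hf).intervalIntegrable
  · exact ((continuousOn_fst_of_contDiffAt hf').mono uIoc_subset_uIcc).aestronglyMeasurable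
      measurableSet_uIoc
  · exact Eventually.of_forall fun s hs x hx => hx.2 s (uIoc_subset_uIcc hs)
  · exact intervalIntegrable_const
  · refine Eventually.of_forall fun s hs x hx => ?_
    have h1 := (hx.1 s (uIoc_subset_uIcc hs)).differentiableAt (by simp)
    exact (h1.comp x (f := fun y : E => (s, y)) (by fun_prop)).hasFDerivAt

/-- Induction on the order by differentiating under the integral. The target `W` is quantified
inside because the derivative takes values in `E →L[ℝ] W`; the spaces live in `Type` so that this
one does too. -/
theorem contDiffAt_intervalIntegral_nat {E : Type} [NormedAddCommGroup E] [NormedSpace ℝ E]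
    {a b : ℝ} {p : E} (n : ℕ) : ∀ {W : Type} [NormedAddCommGroup W] [NormedSpace ℝ W]
    {f : ℝ → E → W}, (∀ s ∈ uIcc a b, ContDiffAt ℝ n (fun q : ℝ × E => f q.1 q.2) (s, p)) →
    ContDiffAt ℝ n (fun x => ∫ s in a..b, f s x) p := by
  induction n with
  | zero =>
    intro W _ _ f hf
    have hev := eventually_forall_contDiffAt (n := 0) isCompact_uIcc hf
    refine contDiffAt_zero.2 ⟨_, hev.eventually_nhds, fun x hx => ?_⟩
    exact (continuousAt_intervalIntegral_of_eventually
      (Eventually.mono hx fun y hy s hs => (hy s hs).continuousAt)).continuousWithinAt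
  | succ n ih =>
    intro W _ _ f hf
    have hev := eventually_forall_contDiffAt isCompact_uIcc hf
    push_cast at hf ⊢
    refine contDiffAt_succ_iff_hasFDerivAt.2
      ⟨fun x => ∫ s in a..b, fderiv ℝ (f s) x, ⟨_, hev, fun x hx => ?_⟩, ?_⟩
    · exact hasFDerivAt_intervalIntegral_of_contDiffAt fun s hs => (hx s hs).of_le (by simp)
    · exact ih fun s hs => ContDiffAt.fderiv_snd (hf s hs)

theorem contDiffAt_intervalIntegral {n : ℕ∞} {f : ℝ → E → W} {a b : ℝ} {p : E}
    (hf : ∀ s ∈ uIcc a b, ContDiffAt ℝ n (fun q : ℝ × E => f q.1 q.2) (s, p)) :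
    ContDiffAt ℝ n (fun x => ∫ s in a..b, f s x) p :=
  contDiffWithinAt_univ.1 <| contDiffWithinAt_iff_forall_nat_le.2 fun k hk =>
    (contDiffAt_intervalIntegral_nat k fun s hs =>
      (hf s hs).of_le (by exact_mod_cast hk)).contDiffWithinAt

theorem contDiffAt_primitive {n : ℕ∞} {f : ℝ → E → W} {a t : ℝ} {p : E}
    (hf : ∀ s ∈ uIcc a t, ContDiffAt ℝ n (fun q : ℝ × E => f q.1 q.2) (s, p)) :
    ContDiffAt ℝ n (fun q : ℝ × E => ∫ s in a..q.1, f s q.2) (t, p) := by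
  -- The substitution `s = a + (t - a) r` moves the variable endpoint into the integrand, leaving a
  -- fixed interval with parameter `(t, x)`.
  have h : (fun q : ℝ × E => ∫ s in a..q.1, f s q.2) =
      fun q : ℝ × E => ∫ r in (0 : ℝ)..1, (q.1 - a) • f (a + (q.1 - a) * r) q.2 := by
    funext q
    rw [intervalIntegral.integral_smul,
      intervalIntegral.smul_integral_comp_add_mul (fun s => f s q.2)]
    simp
  rw [h]
  refine contDiffAt_intervalIntegral (f := fun r (q : ℝ × E) =>
    (q.1 - a) • f (a + (q.1 - a) * r) q.2) fun r hr => ?_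
  refine ContDiffAt.smul (by fun_prop) ?_
  refine ContDiffAt.comp (f := fun q : ℝ × ℝ × E => (a + (q.2.1 - a) * q.1, q.2.2))
    (g := fun q : ℝ × E => f q.1 q.2) (r, t, p) (hf _ ?_) (by fun_prop)
  have := (convex_uIcc a t).add_smul_sub_mem left_mem_uIcc right_mem_uIcc
    (by simpa using hr : r ∈ Icc (0 : ℝ) 1)
  simpa [mul_comm] using this

end ParametricIntegral

/-! ### Time evolution of functions depending on a space parameter. -/

section TimeDependent

open Set Filter Topology MeasureTheory intervalIntegral

variable {E W : Type} [NormedAddCommGroup E] [NormedSpace ℝ E] [NormedAddCommGroup W]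
  [NormedSpace ℝ W] {J : Set ℝ} {U : Set E}

theorem ContDiffOn.contDiffAt_prod {n : WithTop ℕ∞} {f : ℝ × E → W} (hJ : IsOpen J) (hU : IsOpen U)
    (hf : ContDiffOn ℝ n f (J ×ˢ U)) {t : ℝ} {X : E} (ht : t ∈ J) (hX : X ∈ U) :
    ContDiffAt ℝ n f (t, X) :=
  hf.contDiffAt ((hJ.prod hU).mem_nhds ⟨ht, hX⟩)

theorem contDiffOn_primitive {n : ℕ∞} {f : ℝ → E → W} (hJ : IsOpen J) (hJc : J.OrdConnected)
    (hU : IsOpen U) (hf : ContDiffOn ℝ n (fun q : ℝ × E => f q.1 q.2) (J ×ˢ U)) {a : ℝ}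
    (ha : a ∈ J) :
    ContDiffOn ℝ n (fun q : ℝ × E => ∫ s in a..q.1, f s q.2) (J ×ˢ U) := fun _ hq =>
  (contDiffAt_primitive fun _ hs =>
    hf.contDiffAt_prod hJ hU (hJc.uIcc_subset ha hq.1 hs) hq.2).contDiffWithinAt

theorem hasDerivAt_primitive [CompleteSpace W] {f : ℝ → W} (hJ : IsOpen J) (hJc : J.OrdConnected)
    (hf : ContinuousOn f J) {a t : ℝ} (ha : a ∈ J) (ht : t ∈ J) :
    HasDerivAt (fun r => ∫ s in a..r, f s) (f t) t :=
  integral_hasDerivAt_right ((hf.mono (hJc.uIcc_subset ha ht)).intervalIntegrable)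
    (hf.stronglyMeasurableAtFilter hJ t ht) (hf.continuousAt (hJ.mem_nhds ht))

theorem eq_add_integral_of_hasDerivAt [CompleteSpace W] {f h : ℝ → W} (hJc : J.OrdConnected)
    (hf : ∀ t ∈ J, HasDerivAt f (h t) t) (hh : ContinuousOn h J) {a t : ℝ} (ha : a ∈ J)
    (ht : t ∈ J) : f t = f a + ∫ s in a..t, h s := by
  rw [integral_eq_sub_of_hasDerivAt (fun s hs => hf s (hJc.uIcc_subset ha ht hs))
    ((hh.mono (hJc.uIcc_subset ha ht)).intervalIntegrable)]
  simp

/-- Differentiation with respect to a parameter commutes with differentiation in time. -/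
theorem hasDerivAt_fderiv_of_hasDerivAt [CompleteSpace W] {f h : ℝ → E → W} (hJ : IsOpen J)
    (hJc : J.OrdConnected) (hU : IsOpen U)
    (hf : ∀ t ∈ J, ∀ X ∈ U, HasDerivAt (fun s => f s X) (h t X) t)
    (hfd : ∀ t ∈ J, ∀ X ∈ U, DifferentiableAt ℝ (f t) X)
    (hh : ContDiffOn ℝ 1 (fun q : ℝ × E => h q.1 q.2) (J ×ˢ U)) {t : ℝ} (ht : t ∈ J) {X : E}
    (hX : X ∈ U) :
    HasDerivAt (fun s => fderiv ℝ (f s) X) (fderiv ℝ (h t) X) t := by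
  have hcd : ∀ s ∈ J, ∀ Y ∈ U, ContDiffAt ℝ 1 (fun q : ℝ × E => h q.1 q.2) (s, Y) :=
    fun s hs Y hY => hh.contDiffAt_prod hJ hU hs hY
  have hcd' : ∀ s ∈ J, ContDiffAt ℝ 0 (fun q : ℝ × E => fderiv ℝ (h q.1) q.2) (s, X) :=
    fun s hs => ContDiffAt.fderiv_snd (by simpa using hcd s hs X hX)
  -- Integrating in time first requires only differentiability of each `f t` and a `C¹` rate `h`,
  -- not second derivatives of `f`. This is why potentials of class `C¹` suffice in the converse
  -- statements.
  have key : ∀ s ∈ J, fderiv ℝ (f s) X = fderiv ℝ (f t) X + ∫ r in t..s, fderiv ℝ (h r) X := by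
    intro s hs
    have h1 : f s =ᶠ[𝓝 X] fun Y => f t Y + ∫ r in t..s, h r Y := by
      filter_upwards [hU.mem_nhds hX] with Y hY
      exact eq_add_integral_of_hasDerivAt hJc (fun r hr => hf r hr Y hY)
        (continuousOn_fst_of_contDiffAt fun r hr => hcd r hr Y hY) ht hs
    rw [h1.fderiv_eq]
    exact ((hfd t ht X hX).hasFDerivAt.add (hasFDerivAt_intervalIntegral_of_contDiffAt
      fun r hr => hcd r (hJc.uIcc_subset ht hs hr) X hX)).fderiv
  have h2 := (hasDerivAt_primitive hJ hJc (continuousOn_fst_of_contDiffAt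
    (f := fun r Y => fderiv ℝ (h r) Y) hcd') ht ht).const_add (fderiv ℝ (f t) X)
  exact h2.congr_of_eventuallyEq (by filter_upwards [hJ.mem_nhds ht] with s hs using key s hs)

theorem eq_of_hasDerivAt_zero {f : ℝ → W} (hJ : IsOpen J) (hJc : J.OrdConnected)
    (hf : ∀ t ∈ J, HasDerivAt f 0 t) {s t : ℝ} (hs : s ∈ J) (ht : t ∈ J) : f s = f t :=
  hJ.is_const_of_deriv_eq_zero hJc.isPreconnected
    (fun r hr => (hf r hr).differentiableAt.differentiableWithinAt)
    (fun r hr => (hf r hr).deriv) hs ht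

end TimeDependent

/-! ### Kinematics: passage between the Eulerian and reference descriptions. -/

namespace Fluid.Motion

open Set Filter Topology

variable {m : ℕ∞} (M : Motion m) {S : Set Space} {W : Type} [NormedAddCommGroup W]
  [NormedSpace ℝ W]

/-- The velocity in the reference (Lagrangian) description. -/
noncomputable def refVelocity (t : ℝ) (X : Space) : Space :=
  deriv (fun τ => M.pos τ X) t

variable {M}

theorem add_two_eq (m : ℕ∞) : (m : WithTop ℕ∞) + 2 = (m : WithTop ℕ∞) + 1 + 1 := by
  rw [add_assoc, one_add_one_eq_two]

theorem add_one_le_add_two (m : ℕ∞) : (m : WithTop ℕ∞) + 1 ≤ (m : WithTop ℕ∞) + 2 := by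
  rw [add_two_eq]; exact le_self_add

theorem one_le_add_two (m : ℕ∞) : (1 : WithTop ℕ∞) ≤ (m : WithTop ℕ∞) + 2 :=
  le_add_self.trans (add_one_le_add_two m)

theorem contDiffAt_pos {t : ℝ} (ht : t ∈ M.time) {X : Space} (hX : X ∈ M.ref) :
    ContDiffAt ℝ ((m : WithTop ℕ∞) + 2) (fun q : ℝ × Space => M.pos q.1 q.2) (t, X) :=
  M.contDiffOn_pos.contDiffAt_prod M.isOpen_time M.isOpen_ref ht hX

theorem hasFDerivAt_pos_prod {t : ℝ} (ht : t ∈ M.time) {X : Space} (hX : X ∈ M.ref) :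
    HasFDerivAt (fun q : ℝ × Space => M.pos q.1 q.2)
      (fderiv ℝ (fun q : ℝ × Space => M.pos q.1 q.2) (t, X)) (t, X) :=
  ((contDiffAt_pos ht hX).differentiableAt (by simp)).hasFDerivAt

theorem hasFDerivAt_pos {t : ℝ} (ht : t ∈ M.time) {X : Space} (hX : X ∈ M.ref) :
    HasFDerivAt (M.pos t) (M.defGrad t X) X :=
  ((hasFDerivAt_pos_prod ht hX).comp X (f := fun Y : Space => (t, Y))
    ((hasFDerivAt_const t X).prodMk (hasFDerivAt_id X))).differentiableAt.hasFDerivAt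

theorem hasDerivAt_pos' {t : ℝ} (ht : t ∈ M.time) {X : Space} (hX : X ∈ M.ref) :
    HasDerivAt (fun τ => M.pos τ X)
      (fderiv ℝ (fun q : ℝ × Space => M.pos q.1 q.2) (t, X) (1, 0)) t :=
  (hasFDerivAt_pos_prod ht hX).comp_hasDerivAt t (f := fun τ : ℝ => (τ, X))
    ((hasDerivAt_id t).prodMk (hasDerivAt_const t X))

theorem hasDerivAt_pos {t : ℝ} (ht : t ∈ M.time) {X : Space} (hX : X ∈ M.ref) :
    HasDerivAt (fun τ => M.pos τ X) (M.refVelocity t X) t :=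
  (hasDerivAt_pos' ht hX).differentiableAt.hasDerivAt

theorem fderiv_pos_prod_inr {t : ℝ} (ht : t ∈ M.time) {X : Space} (hX : X ∈ M.ref) (ξ : Space) :
    fderiv ℝ (fun q : ℝ × Space => M.pos q.1 q.2) (t, X) (0, ξ) = M.defGrad t X ξ := by
  have h := (hasFDerivAt_pos_prod ht hX).comp X (f := fun Y : Space => (t, Y))
    ((hasFDerivAt_const t X).prodMk (hasFDerivAt_id X))
  have h2 := DFunLike.congr_fun (h.unique (hasFDerivAt_pos ht hX)) ξ
  simpa using h2

theorem contDiffOn_defGrad :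
    ContDiffOn ℝ ((m : WithTop ℕ∞) + 1) (fun q : ℝ × Space => M.defGrad q.1 q.2)
      (M.time ×ˢ M.ref) := fun q hq =>
  (ContDiffAt.fderiv_snd (f := M.pos)
    (by rw [← add_two_eq]; exact contDiffAt_pos hq.1 hq.2)).contDiffWithinAt

theorem contDiffOn_refVelocity :
    ContDiffOn ℝ ((m : WithTop ℕ∞) + 1) (fun q : ℝ × Space => M.refVelocity q.1 q.2)
      (M.time ×ˢ M.ref) := by
  have h := M.contDiffOn_pos.fderiv_of_isOpen (m := (m : WithTop ℕ∞) + 1)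
    (M.isOpen_time.prod M.isOpen_ref) (by rw [add_two_eq])
  refine (h.clm_apply (contDiffOn_const (c := ((1, 0) : ℝ × Space)))).congr fun q hq => ?_
  exact (hasDerivAt_pos' hq.1 hq.2).deriv

theorem hasDerivAt_defGrad {t : ℝ} (ht : t ∈ M.time) {X : Space} (hX : X ∈ M.ref) :
    HasDerivAt (fun τ => M.defGrad τ X) (fderiv ℝ (M.refVelocity t) X) t :=
  hasDerivAt_fderiv_of_hasDerivAt M.isOpen_time M.ordConnected_time M.isOpen_ref
    (fun _ hs _ hY => hasDerivAt_pos hs hY)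
    (fun _ hs _ hY => (hasFDerivAt_pos hs hY).differentiableAt)
    (contDiffOn_refVelocity.of_le le_add_self) ht hX

theorem label_pos {t : ℝ} (ht : t ∈ M.time) {X : Space} (hX : X ∈ M.ref) :
    M.label t (M.pos t X) = X :=
  (M.injOn_pos t ht).leftInvOn_invFunOn hX

theorem velocity_pos {t : ℝ} (ht : t ∈ M.time) {X : Space} (hX : X ∈ M.ref) :
    M.velocity t (M.pos t X) = M.refVelocity t X := by
  rw [velocity, label_pos ht hX, refVelocity]

theorem exists_defGrad_eq {t : ℝ} (ht : t ∈ M.time) {X : Space} (hX : X ∈ M.ref) :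
    ∃ e : Space ≃L[ℝ] Space, (e : Space →L[ℝ] Space) = M.defGrad t X :=
  M.isInvertible_fderiv_pos t ht X hX

/-- The derivative is block triangular with diagonal blocks 1 and the deformation gradient, hence
injective, hence invertible in finite dimension. This opens the way to the inverse function theorem
in space-time. -/
theorem exists_hasFDerivAt_spaceTime {t : ℝ} (ht : t ∈ M.time) {X : Space} (hX : X ∈ M.ref) :
    ∃ e : (ℝ × Space) ≃L[ℝ] (ℝ × Space),
      HasFDerivAt (fun q : ℝ × Space => (q.1, M.pos q.1 q.2)) (e : (ℝ × Space) →L[ℝ] ℝ × Space)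
        (t, X) := by
  set L : (ℝ × Space) →L[ℝ] ℝ × Space := (ContinuousLinearMap.fst ℝ ℝ Space).prod
    (fderiv ℝ (fun q : ℝ × Space => M.pos q.1 q.2) (t, X)) with hL
  have hinj : Function.Injective L.toLinearMap := by
    refine (injective_iff_map_eq_zero _).2 fun ⟨s, ξ⟩ h => ?_
    obtain ⟨e, he⟩ := exists_defGrad_eq ht hX
    have h' := Prod.ext_iff.1 h
    obtain rfl : s = 0 := h'.1
    have h2 : M.defGrad t X ξ = 0 := (fderiv_pos_prod_inr ht hX ξ).symm.trans h'.2
    rw [← he] at h2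
    have : ξ = 0 := by simpa using h2
    simp [this]
  refine ⟨(LinearEquiv.ofInjectiveEndo L.toLinearMap hinj).toContinuousLinearEquiv, ?_⟩
  have hE : ((LinearEquiv.ofInjectiveEndo L.toLinearMap hinj).toContinuousLinearEquiv :
      (ℝ × Space) →L[ℝ] ℝ × Space) = L := by
    exact ContinuousLinearMap.ext fun _ => rfl
  rw [hE]
  exact hasFDerivAt_fst.prodMk (hasFDerivAt_pos_prod ht hX)

theorem contDiffAt_spaceTime {t : ℝ} (ht : t ∈ M.time) {X : Space} (hX : X ∈ M.ref) :
    ContDiffAt ℝ ((m : WithTop ℕ∞) + 2) (fun q : ℝ × Space => (q.1, M.pos q.1 q.2)) (t, X) :=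
  contDiffAt_fst.prodMk (contDiffAt_pos ht hX)

/-- Near the image point, `label` is the space component of the local inverse of the space-time map:
injectivity of `pos t` on `ref` identifies the two. -/
theorem contDiffAt_label {t : ℝ} (ht : t ∈ M.time) {X : Space} (hX : X ∈ M.ref) :
    ContDiffAt ℝ ((m : WithTop ℕ∞) + 2) (fun p : ℝ × Space => M.label p.1 p.2)
      (t, M.pos t X) := by
  obtain ⟨e, he⟩ := exists_hasFDerivAt_spaceTime ht hX
  have hc := contDiffAt_spaceTime ht hX
  have hn : (m : WithTop ℕ∞) + 2 ≠ 0 := by simp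
  have hg := hc.to_localInverse he hn
  have hs := hc.hasStrictFDerivAt' he hn
  refine hg.snd.congr_of_eventuallyEq ?_
  have h1 := hs.eventually_right_inverse
  have h2 : ∀ᶠ p in 𝓝 (t, M.pos t X), hc.localInverse he hn p ∈ M.time ×ˢ M.ref := by
    refine hg.continuousAt.eventually_mem ?_
    rw [hc.localInverse_apply_image he hn]
    exact (M.isOpen_time.prod M.isOpen_ref).mem_nhds ⟨ht, hX⟩
  filter_upwards [h1, h2] with p hp1 hp2
  have h3 : ((hc.localInverse he hn p).1,
    M.pos (hc.localInverse he hn p).1 (hc.localInverse he hn p).2) = p := hp1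
  have h4 := label_pos hp2.1 hp2.2
  conv_lhs => rw [← h3]
  exact h4

theorem mem_region {t : ℝ} (ht : t ∈ M.time) {X : Space} (hX : X ∈ S) :
    (t, M.pos t X) ∈ M.region S :=
  ⟨ht, X, hX, rfl⟩

theorem exists_of_mem_region {p : ℝ × Space} (hp : p ∈ M.region S) :
    ∃ t ∈ M.time, ∃ X ∈ S, p = (t, M.pos t X) := by
  obtain ⟨t, x⟩ := p
  obtain ⟨ht, X, hX, h⟩ := hp
  exact ⟨t, ht, X, hX, Prod.ext rfl h.symm⟩

/-- The space-time map is open at each point, by invertibility of its strict derivative. Regularity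
on the region is thus regularity at each of its points. -/
theorem region_mem_nhds (hS : IsOpen S) (hSr : S ⊆ M.ref) {t : ℝ} (ht : t ∈ M.time) {X : Space}
    (hX : X ∈ S) : M.region S ∈ 𝓝 (t, M.pos t X) := by
  obtain ⟨e, he⟩ := exists_hasFDerivAt_spaceTime ht (hSr hX)
  have hs := (contDiffAt_spaceTime ht (hSr hX)).hasStrictFDerivAt' he (by simp)
  have h := image_mem_map (m := fun q : ℝ × Space => (q.1, M.pos q.1 q.2))
    ((M.isOpen_time.prod hS).mem_nhds (⟨ht, hX⟩ : (t, X) ∈ M.time ×ˢ S))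
  rw [hs.map_nhds_eq_of_equiv] at h
  refine mem_of_superset h ?_
  rintro _ ⟨q, hq, rfl⟩
  exact mem_region hq.1 hq.2

theorem IsOfClass.contDiffAt {n : WithTop ℕ∞} {f : ℝ → Space → W} (hf : M.IsOfClass S n f)
    (hS : IsOpen S) (hSr : S ⊆ M.ref) {t : ℝ} (ht : t ∈ M.time) {X : Space} (hX : X ∈ S) :
    ContDiffAt ℝ n (fun p : ℝ × Space => f p.1 p.2) (t, M.pos t X) :=
  ContDiffOn.contDiffAt hf (region_mem_nhds hS hSr ht hX)

theorem IsOfClass.differentiableAt {n : WithTop ℕ∞} {f : ℝ → Space → W} (hf : M.IsOfClass S n f)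
    (hn : 1 ≤ n) (hS : IsOpen S) (hSr : S ⊆ M.ref) {t : ℝ} (ht : t ∈ M.time) {X : Space}
    (hX : X ∈ S) : DifferentiableAt ℝ (f t) (M.pos t X) :=
  ((hf.contDiffAt hS hSr ht hX).differentiableAt (by rintro rfl; simp at hn)).comp
    (M.pos t X) (f := fun x : Space => (t, x)) (by fun_prop)

theorem IsOfClass.contDiffOn_comp_pos {n : WithTop ℕ∞} {f : ℝ → Space → W}
    (hf : M.IsOfClass S n f) (hn : n ≤ (m : WithTop ℕ∞) + 2) (hSr : S ⊆ M.ref) :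
    ContDiffOn ℝ n (fun q : ℝ × Space => f q.1 (M.pos q.1 q.2)) (M.time ×ˢ S) := by
  refine ContDiffOn.comp (g := fun p : ℝ × Space => f p.1 p.2)
    (f := fun q : ℝ × Space => (q.1, M.pos q.1 q.2)) hf ?_ fun q hq => mem_region hq.1 hq.2
  exact contDiffOn_fst.prodMk ((M.contDiffOn_pos.of_le hn).mono (prod_mono le_rfl hSr))

theorem isOfClass_comp_label {n : WithTop ℕ∞} {f : ℝ → Space → W} (hn : n ≤ (m : WithTop ℕ∞) + 2)
    (hSr : S ⊆ M.ref) (hf : ContDiffOn ℝ n (fun q : ℝ × Space => f q.1 q.2) (M.time ×ˢ S)) :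
    M.IsOfClass S n (fun t x => f t (M.label t x)) := by
  refine ContDiffOn.comp (g := fun p : ℝ × Space => f p.1 p.2) (s := M.region S)
    (f := fun p : ℝ × Space => (p.1, M.label p.1 p.2)) hf ?_ ?_
  · refine contDiffOn_fst.prodMk ?_
    intro p hp
    obtain ⟨t, ht, X, hX, rfl⟩ := exists_of_mem_region hp
    exact ((contDiffAt_label ht (hSr hX)).of_le hn).contDiffWithinAt
  · intro p hp
    obtain ⟨t, ht, X, hX, rfl⟩ := exists_of_mem_region hp
    exact ⟨ht, by simpa only [label_pos ht (hSr hX)] using hX⟩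

theorem fderiv_comp_pos {f : Space → W} {t : ℝ} (ht : t ∈ M.time) {X : Space} (hX : X ∈ M.ref)
    (hf : DifferentiableAt ℝ f (M.pos t X)) :
    fderiv ℝ (fun Y => f (M.pos t Y)) X = (fderiv ℝ f (M.pos t X)).comp (M.defGrad t X) :=
  (hf.hasFDerivAt.comp X (hasFDerivAt_pos ht hX)).fderiv

theorem innerSL_gradient (f : Space → ℝ) (x : Space) :
    innerSL ℝ (gradient f x) = fderiv ℝ f x := by
  ext v; simp [gradient]

end Fluid.Motion

/-! ### Dynamics: the equation of motion for the transported momentum. -/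

namespace Fluid.Motion

open Set Filter Topology

variable {m : ℕ∞} (M : Motion m) {S : Set Space}

/-- The covector of the velocity, transported to the reference space. -/
noncomputable def momentum (t : ℝ) (X : Space) : Space →L[ℝ] ℝ :=
  (innerSL ℝ (M.refVelocity t X)).comp (M.defGrad t X)

/-- The density of Lagrangian `V² / 2 - g - Ω`, in the reference description. -/
noncomputable def refLagrangian (g Ω : ℝ → Space → ℝ) (t : ℝ) (X : Space) : ℝ :=
  (1 / 2) * ‖M.refVelocity t X‖ ^ 2 - g t (M.pos t X) - Ω t (M.pos t X)

variable {M}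

theorem defGrad_surjective {t : ℝ} (ht : t ∈ M.time) {X : Space} (hX : X ∈ M.ref) :
    Function.Surjective (M.defGrad t X) := by
  obtain ⟨e, he⟩ := exists_defGrad_eq ht hX
  rw [← he]
  exact e.surjective

theorem comp_defGrad_inj {t : ℝ} (ht : t ∈ M.time) {X : Space} (hX : X ∈ M.ref)
    {L L' : Space →L[ℝ] ℝ} : L.comp (M.defGrad t X) = L'.comp (M.defGrad t X) ↔ L = L' := by
  refine ⟨fun h => ContinuousLinearMap.ext fun v => ?_, fun h => by rw [h]⟩
  obtain ⟨w, rfl⟩ := defGrad_surjective ht hX v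
  exact DFunLike.congr_fun h w

/-- Decompositions of the velocity can thereby be checked on covectors of the reference space, where
gradients become differentials of functions of the particle. -/
theorem innerSL_comp_defGrad_inj {t : ℝ} (ht : t ∈ M.time) {X : Space} (hX : X ∈ M.ref)
    {a b : Space} :
    (innerSL ℝ a).comp (M.defGrad t X) = (innerSL ℝ b).comp (M.defGrad t X) ↔ a = b := by
  rw [comp_defGrad_inj ht hX]
  exact (InnerProductSpace.toDual ℝ Space).injective.eq_iff (a := a) (b := b)

theorem innerSL_gradient_comp_defGrad {f : Space → ℝ} {t : ℝ} (ht : t ∈ M.time) {X : Space}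
    (hX : X ∈ M.ref) (hf : DifferentiableAt ℝ f (M.pos t X)) :
    (innerSL ℝ (gradient f (M.pos t X))).comp (M.defGrad t X) =
      fderiv ℝ (fun Y => f (M.pos t Y)) X := by
  rw [innerSL_gradient, fderiv_comp_pos ht hX hf]

theorem hasDerivAt_refVelocity {t : ℝ} (ht : t ∈ M.time) {X : Space} (hX : X ∈ M.ref) :
    HasDerivAt (fun τ => M.refVelocity τ X) (deriv (fun τ => M.refVelocity τ X) t) t := by
  have h := (contDiffOn_refVelocity.contDiffAt_prod M.isOpen_time M.isOpen_ref ht hX)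
  exact ((h.differentiableAt (by simp)).comp t (f := fun τ : ℝ => (τ, X))
    (by fun_prop)).hasDerivAt

theorem differentiableAt_refVelocity {t : ℝ} (ht : t ∈ M.time) {X : Space} (hX : X ∈ M.ref) :
    DifferentiableAt ℝ (M.refVelocity t) X := by
  have h := (contDiffOn_refVelocity.contDiffAt_prod M.isOpen_time M.isOpen_ref ht hX)
  exact (h.differentiableAt (by simp)).comp X (f := fun Y : Space => (t, Y)) (by fun_prop)

/-- Product rule: the first term is the acceleration; in the second, `dF/dt` is the gradient of
`refVelocity`, so contraction with the velocity gives `d(V²/2)`. -/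
theorem hasDerivAt_momentum {t : ℝ} (ht : t ∈ M.time) {X : Space} (hX : X ∈ M.ref) :
    HasDerivAt (fun τ => M.momentum τ X)
      ((innerSL ℝ (deriv (fun τ => M.refVelocity τ X) t)).comp (M.defGrad t X) +
        fderiv ℝ (fun Y => (1 / 2 : ℝ) * ‖M.refVelocity t Y‖ ^ 2) X) t := by
  have h1 := ((innerSL ℝ (E := Space)).hasFDerivAt.comp_hasDerivAt t
    (hasDerivAt_refVelocity ht hX)).clm_comp (hasDerivAt_defGrad ht hX)
  refine h1.congr_deriv ?_
  congr 1
  have h2 := ((differentiableAt_refVelocity ht hX).hasFDerivAt.norm_sq).const_mul (1 / 2 : ℝ)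
  rw [h2.fderiv]
  ext v
  simp
  rfl

theorem eventually_mem_time {t : ℝ} (ht : t ∈ M.time) : ∀ᶠ τ in 𝓝 t, τ ∈ M.time :=
  M.isOpen_time.mem_nhds ht

/-- The equation of motion in the reference space. -/
theorem motionEquation_iff (hS : IsOpen S) (hSr : S ⊆ M.ref) {T g Ω u : ℝ → Space → ℝ}
    (hT : M.IsOfClass S 1 T) (hg : M.IsOfClass S 1 g) (hΩ : M.IsOfClass S 1 Ω) :
    M.MotionEquation S T g Ω u ↔ ∀ t ∈ M.time, ∀ X ∈ S,
      HasDerivAt (fun τ => M.momentum τ X) (fderiv ℝ (M.refLagrangian g Ω t) X +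
        u t (M.pos t X) • fderiv ℝ (fun Y => T t (M.pos t Y)) X) t := by
  refine forall₂_congr fun t ht => forall₂_congr fun X hX => ?_
  have hXr := hSr hX
  have hTd := hT.differentiableAt le_rfl hS hSr ht hX
  have hgd := hg.differentiableAt le_rfl hS hSr ht hX
  have hΩd := hΩ.differentiableAt le_rfl hS hSr ht hX
  have hv : (fun τ => M.velocity τ (M.pos τ X)) =ᶠ[𝓝 t] fun τ => M.refVelocity τ X := by
    filter_upwards [eventually_mem_time ht] with τ hτ using velocity_pos hτ hXr
  rw [hv.hasDerivAt_iff]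
  -- Both time derivatives exist in any case, so each `HasDerivAt` amounts to an equality of values.
  -- The term `d(V²/2)` occurs in the derivative of the momentum and in that of the Lagrangian, and
  -- cancels.
  have e1 : HasDerivAt (fun τ => M.refVelocity τ X) (u t (M.pos t X) • gradient (T t) (M.pos t X) -
      gradient (fun y => g t y + Ω t y) (M.pos t X)) t ↔
      deriv (fun τ => M.refVelocity τ X) t = u t (M.pos t X) • gradient (T t) (M.pos t X) -
      gradient (fun y => g t y + Ω t y) (M.pos t X) :=
    ⟨fun h => h.deriv, fun h => h ▸ hasDerivAt_refVelocity ht hXr⟩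
  have e2 (L : Space →L[ℝ] ℝ) : HasDerivAt (fun τ => M.momentum τ X) L t ↔
      (innerSL ℝ (deriv (fun τ => M.refVelocity τ X) t)).comp (M.defGrad t X) +
        fderiv ℝ (fun Y => (1 / 2 : ℝ) * ‖M.refVelocity t Y‖ ^ 2) X = L :=
    ⟨fun h => (hasDerivAt_momentum ht hXr).unique h, fun h => h ▸ hasDerivAt_momentum ht hXr⟩
  have e3 : fderiv ℝ (M.refLagrangian g Ω t) X =
      fderiv ℝ (fun Y => (1 / 2 : ℝ) * ‖M.refVelocity t Y‖ ^ 2) X -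
      (innerSL ℝ (gradient (fun y => g t y + Ω t y) (M.pos t X))).comp (M.defGrad t X) := by
    have hp := (hasFDerivAt_pos ht hXr).differentiableAt
    have hv2 : DifferentiableAt ℝ (fun Y => (1 / 2 : ℝ) * ‖M.refVelocity t Y‖ ^ 2) X :=
      ((differentiableAt_refVelocity ht hXr).norm_sq ℝ).const_mul _
    have hs : DifferentiableAt ℝ (fun Y => g t (M.pos t Y) + Ω t (M.pos t Y)) X :=
      (hgd.comp X hp).add (hΩd.comp X hp)
    rw [innerSL_gradient_comp_defGrad ht hXr (f := fun y => g t y + Ω t y) (hgd.add hΩd),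
      ← fderiv_fun_sub hv2 hs]
    congr 1
    funext Y
    simp only [refLagrangian]
    ring
  rw [e1, e2, e3, ← innerSL_gradient_comp_defGrad ht hXr hTd, ← innerSL_comp_defGrad_inj ht hXr]
  simp only [map_sub, map_smul, ContinuousLinearMap.sub_comp, ContinuousLinearMap.smul_comp]
  constructor
  · intro h
    rw [h]
    abel
  · intro h
    rw [← sub_eq_zero] at h ⊢
    rw [← h]
    abel

theorem contDiffOn_refLagrangian {n : WithTop ℕ∞} (hn : n ≤ (m : WithTop ℕ∞) + 1)
    (hSr : S ⊆ M.ref) {g Ω : ℝ → Space → ℝ} (hg : M.IsOfClass S n g) (hΩ : M.IsOfClass S n Ω) :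
    ContDiffOn ℝ n (fun q : ℝ × Space => M.refLagrangian g Ω q.1 q.2) (M.time ×ˢ S) := by
  have hn' := hn.trans (add_one_le_add_two m)
  have hv := (contDiffOn_refVelocity.of_le hn).mono (prod_mono (le_refl M.time) hSr)
  exact ((contDiffOn_const.mul (hv.norm_sq ℝ)).sub (hg.contDiffOn_comp_pos hn' hSr)).sub
    (hΩ.contDiffOn_comp_pos hn' hSr)

theorem HasMaterialDeriv.hasDerivAt_fderiv (hS : IsOpen S) (hSr : S ⊆ M.ref)
    {f h : ℝ → Space → ℝ} (hf : M.IsOfClass S 1 f) (hd : M.HasMaterialDeriv S f h)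
    (hh : ContDiffOn ℝ 1 (fun q : ℝ × Space => h q.1 (M.pos q.1 q.2)) (M.time ×ˢ S)) {t : ℝ}
    (ht : t ∈ M.time) {X : Space} (hX : X ∈ S) :
    HasDerivAt (fun τ => fderiv ℝ (fun Y => f τ (M.pos τ Y)) X)
      (fderiv ℝ (fun Y => h t (M.pos t Y)) X) t :=
  hasDerivAt_fderiv_of_hasDerivAt (f := fun τ Y => f τ (M.pos τ Y))
    (h := fun τ Y => h τ (M.pos τ Y)) M.isOpen_time M.ordConnected_time hS
    hd (fun _ hs _ hY => (hf.differentiableAt le_rfl hS hSr hs hY).comp _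
      (hasFDerivAt_pos hs (hSr hY)).differentiableAt) hh ht hX

/-- The gradient of a conserved scalar is a convected covector; this applies to `T` and to `ν`. -/
theorem HasMaterialDeriv.hasDerivAt_fderiv_of_zero (hS : IsOpen S) (hSr : S ⊆ M.ref)
    {f : ℝ → Space → ℝ} (hf : M.IsOfClass S 1 f) (hd : M.HasMaterialDeriv S f fun _ _ => 0)
    {t : ℝ} (ht : t ∈ M.time) {X : Space} (hX : X ∈ S) :
    HasDerivAt (fun τ => fderiv ℝ (fun Y => f τ (M.pos τ Y)) X) 0 t := by
  simpa using hd.hasDerivAt_fderiv hS hSr hf contDiffOn_const ht hX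

/-- The potential equations imply the equation of motion. -/
theorem PotentialSystem.motionEquation (hS : IsOpen S) (hSr : S ⊆ M.ref)
    {T g Ω u φ ψ : ℝ → Space → ℝ} {C : ℝ → Space → Space}
    (hT : M.IsOfClass S 1 T) (hg : M.IsOfClass S 1 g) (hΩ : M.IsOfClass S 1 Ω)
    (hφ : M.IsOfClass S 1 φ) (h : M.PotentialSystem S T g Ω u φ ψ C) :
    M.MotionEquation S T g Ω u := by
  refine (motionEquation_iff hS hSr hT hg hΩ).2 fun t ht X hX => ?_
  have hL := contDiffOn_refLagrangian (M := M) (n := 1) le_add_self hSr hg hΩ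
  have hφ' : HasDerivAt (fun τ => fderiv ℝ (fun Y => φ τ (M.pos τ Y)) X)
      (fderiv ℝ (M.refLagrangian g Ω t) X) t := by
    have h1 : ∀ τ ∈ M.time, ∀ Y ∈ S, HasDerivAt (fun τ => φ τ (M.pos τ Y))
        (M.refLagrangian g Ω τ Y) τ := fun τ hτ Y hY => by
      simpa only [refLagrangian, velocity_pos hτ (hSr hY)] using h.deriv_phi τ hτ Y hY
    exact hasDerivAt_fderiv_of_hasDerivAt (f := fun τ Y => φ τ (M.pos τ Y))
      M.isOpen_time M.ordConnected_time hS h1 (fun _ hs _ hY =>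
      (hφ.differentiableAt le_rfl hS hSr hs hY).comp _
      (hasFDerivAt_pos hs (hSr hY)).differentiableAt) hL ht hX
  have hT' := h.deriv_T.hasDerivAt_fderiv_of_zero hS hSr hT ht hX
  -- The three terms of the transported velocity have time derivatives `dL`, `u dθ` (as `dθ` is
  -- constant in time) and 0.
  have key := (hφ'.add ((h.deriv_psi t ht X hX).smul hT')).add (h.convected_C t ht X hX)
  refine (key.congr_of_eventuallyEq ?_).congr_deriv (by simp)
  filter_upwards [eventually_mem_time ht] with τ hτ
  simp only [Pi.add_apply, Pi.smul_apply']
  rw [momentum, ← velocity_pos hτ (hSr hX), h.velocity_eq τ hτ _ (mem_image_of_mem _ hX),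
    ← innerSL_gradient_comp_defGrad hτ (hSr hX) (hφ.differentiableAt le_rfl hS hSr hτ hX),
    ← innerSL_gradient_comp_defGrad hτ (hSr hX) (hT.differentiableAt le_rfl hS hSr hτ hX)]
  simp only [map_add, map_smul, ContinuousLinearMap.add_comp, ContinuousLinearMap.smul_comp]

/-- In the reference space the covector of `γ grad ν` is `γ dν`, a product of two factors constant
in time. -/
theorem ClebschSystem.potentialSystem (hS : IsOpen S) (hSr : S ⊆ M.ref)
    {T g Ω u φ ψ γ ν : ℝ → Space → ℝ} (hν : M.IsOfClass S 1 ν)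
    (h : M.ClebschSystem S T g Ω u φ ψ γ ν) :
    M.PotentialSystem S T g Ω u φ ψ fun t x => γ t x • gradient (ν t) x where
  velocity_eq := h.velocity_eq
  deriv_T := h.deriv_T
  deriv_phi := h.deriv_phi
  deriv_psi := h.deriv_psi
  convected_C t ht X hX := by
    have hν' := h.deriv_nu.hasDerivAt_fderiv_of_zero hS hSr hν ht hX
    refine (((h.deriv_gamma t ht X hX).smul hν').congr_of_eventuallyEq ?_).congr_deriv (by simp)
    filter_upwards [eventually_mem_time ht] with τ hτ
    simp only [Pi.smul_apply']
    rw [← innerSL_gradient_comp_defGrad hτ (hSr hX) (hν.differentiableAt le_rfl hS hSr hτ hX)]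
    simp only [map_smul, ContinuousLinearMap.smul_comp]

theorem IsOfClass.mono {S' : Set Space} {n n' : WithTop ℕ∞} {W : Type} [NormedAddCommGroup W]
    [NormedSpace ℝ W] {f : ℝ → Space → W} (hf : M.IsOfClass S n f) (hn : n' ≤ n) (hS : S' ⊆ S) :
    M.IsOfClass S' n' f :=
  (ContDiffOn.of_le hf hn).mono fun _ hp => ⟨hp.1, image_mono hS hp.2⟩

/-- The flow system gives the decomposition of the momentum in the reference space. -/
theorem momentum_eq_of_motionEquation {T g Ω u : ℝ → Space → ℝ} (hT : M.IsOfClass M.ref 1 T)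
    (hg : M.IsOfClass M.ref 1 g) (hΩ : M.IsOfClass M.ref 1 Ω)
    (hd : M.HasMaterialDeriv M.ref T fun _ _ => 0) (hM : M.MotionEquation M.ref T g Ω u)
    {Φ Ψ : ℝ → Space → ℝ} {a : ℝ} (ha : a ∈ M.time)
    (hΦd : ∀ t ∈ M.time, ∀ X ∈ M.ref, DifferentiableAt ℝ (Φ t) X)
    (hΦ : ∀ t ∈ M.time, ∀ X ∈ M.ref, HasDerivAt (fun τ => Φ τ X) (M.refLagrangian g Ω t X) t)
    (hΨ : ∀ t ∈ M.time, ∀ X ∈ M.ref, HasDerivAt (fun τ => Ψ τ X) (u t (M.pos t X)) t)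
    (hΦa : ∀ X, Φ a X = 0) (hΨa : ∀ X, Ψ a X = 0) {t : ℝ} (ht : t ∈ M.time) {X : Space}
    (hX : X ∈ M.ref) :
    M.momentum t X = fderiv ℝ (Φ t) X + Ψ t X • fderiv ℝ (fun Y => T t (M.pos t Y)) X +
      M.momentum a X := by
  have hL := contDiffOn_refLagrangian (M := M) (n := 1) le_add_self le_rfl hg hΩ
  have key : ∀ τ ∈ M.time, HasDerivAt (fun τ => M.momentum τ X - (fderiv ℝ (Φ τ) X +
      Ψ τ X • fderiv ℝ (fun Y => T τ (M.pos τ Y)) X)) 0 τ := by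
    intro τ hτ
    have h1 := (motionEquation_iff M.isOpen_ref le_rfl hT hg hΩ).1 hM τ hτ X hX
    have h2 := hasDerivAt_fderiv_of_hasDerivAt M.isOpen_time M.ordConnected_time M.isOpen_ref
      hΦ hΦd hL hτ hX
    have h3 := hd.hasDerivAt_fderiv_of_zero M.isOpen_ref le_rfl hT hτ hX
    exact (h1.sub (h2.add ((hΨ τ hτ X hX).smul h3))).congr_deriv (by simp)
  have h := eq_of_hasDerivAt_zero M.isOpen_time M.ordConnected_time key ht ha
  have h0 : Φ a = fun _ => 0 := funext hΦa
  simp only [h0, hΨa, fderiv_fun_const, zero_smul, add_zero, Pi.zero_apply, sub_zero] at h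
  rw [← h]
  abel

end Fluid.Motion

/-! ### Local decomposition of a covector field near a regular point of a function. -/

section LocalPotentials

open Set Filter Topology intervalIntegral Fluid

/-- The solution integrates `β` along the lines of direction `v`, starting from the hyperplane `l =
l p`; since `l v = 1`, the point `y + s • v` meets it at `s = l p - l y`. No regularity is lost. -/
theorem exists_primitive_along {E : Type} [NormedAddCommGroup E] [NormedSpace ℝ E] {n : ℕ∞}
    (hn : 1 ≤ n) {V : Set E} (hV : IsOpen V) {β : E → ℝ} (hβ : ContDiffOn ℝ n β V) {p : E}
    (hp : p ∈ V) {v : E} {l : E →L[ℝ] ℝ} (hl : l v = 1) :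
    ∃ B : Set E, IsOpen B ∧ p ∈ B ∧ B ⊆ V ∧ ∃ φ : E → ℝ, ContDiffOn ℝ n φ B ∧
      ∀ y ∈ B, fderiv ℝ φ y v = β y := by
  obtain ⟨ε, hε, hεV⟩ := Metric.isOpen_iff.1 hV p hp
  have hv : 0 < 1 + ‖v‖ := by positivity
  -- Chosen so that `r + r * ‖v‖ = ε`: points of the ball of radius `r`, moved by `s • v` with `|s|
  -- < r`, stay in `V`.
  set r := ε / (1 + ‖v‖) with hr
  have hr0 : 0 < r := div_pos hε hv
  have hrε : r + r * ‖v‖ = ε := by rw [hr]; field_simp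
  set J : Set ℝ := Ioo (-r) r with hJ
  have h0J : (0 : ℝ) ∈ J := ⟨by linarith, hr0⟩
  have hmem : ∀ s ∈ J, ∀ y ∈ Metric.ball p r, y + s • v ∈ V := by
    intro s hs y hy
    refine hεV ?_
    rw [mem_ball_iff_norm] at hy ⊢
    have h1 : ‖s • v‖ ≤ r * ‖v‖ := by
      rw [norm_smul]
      exact mul_le_mul_of_nonneg_right (abs_le.2 ⟨hs.1.le, hs.2.le⟩) (norm_nonneg _)
    calc ‖y + s • v - p‖ = ‖(y - p) + s • v‖ := by congr 1; abel
      _ ≤ ‖y - p‖ + ‖s • v‖ := norm_add_le _ _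
      _ < ε := by linarith
  have hf : ContDiffOn ℝ n (fun q : ℝ × E => β (q.2 + q.1 • v)) (J ×ˢ Metric.ball p r) :=
    hβ.comp (by fun_prop) fun q hq => hmem q.1 hq.1 q.2 hq.2
  have hΦ := contDiffOn_primitive (f := fun s y => β (y + s • v)) isOpen_Ioo ordConnected_Ioo
    Metric.isOpen_ball hf h0J
  refine ⟨Metric.ball p r ∩ {y | l p - l y ∈ J}, Metric.isOpen_ball.inter
    (isOpen_Ioo.preimage (by fun_prop)), ⟨Metric.mem_ball_self hr0, by simpa using h0J⟩,
    fun y hy => by simpa using hmem 0 h0J y hy.1,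
    fun y => -∫ s in (0 : ℝ)..(l p - l y), β (y + s • v), ?_, ?_⟩
  · exact (hΦ.comp (f := fun y : E => (l p - l y, y)) (by fun_prop) fun y hy => ⟨hy.2, hy.1⟩).neg
  · intro y hy
    have hcd : DifferentiableAt ℝ (fun y => -∫ s in (0 : ℝ)..(l p - l y), β (y + s • v)) y := by
      have h1 : DifferentiableAt ℝ (fun q : ℝ × E => ∫ s in (0 : ℝ)..q.1, β (q.2 + s • v))
          (l p - l y, y) :=
        (hΦ.contDiffAt_prod isOpen_Ioo Metric.isOpen_ball hy.2 hy.1).differentiableAt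
          (by rintro h; norm_cast at h; simp [h] at hn)
      exact (h1.comp y (f := fun y : E => (l p - l y, y)) (by fun_prop)).neg
    have hline : HasDerivAt (fun h : ℝ => y + h • v) v 0 := by
      simpa using ((hasDerivAt_id (0 : ℝ)).smul_const v).const_add y
    have h1 := HasFDerivAt.comp_hasDerivAt_of_eq (0 : ℝ) hcd.hasFDerivAt hline (by simp)
    have hc : ContinuousOn (fun s : ℝ => β (y + s • v)) J := fun s hs =>
      (hβ.continuousOn.continuousAt (hV.mem_nhds (hmem s hs y hy.1))).comp_continuousWithinAt
        (f := fun s : ℝ => y + s • v) (by fun_prop)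
    have h2 : HasDerivAt (fun h : ℝ => ∫ s in h..(l p - l y), β (y + s • v))
        (-β (y + (0 : ℝ) • v)) 0 :=
      integral_hasDerivAt_left
        ((hc.mono (ordConnected_Ioo.uIcc_subset h0J hy.2)).intervalIntegrable)
        (hc.stronglyMeasurableAtFilter isOpen_Ioo 0 h0J)
        (hc.continuousAt (isOpen_Ioo.mem_nhds h0J))
    have h3 := h2.neg
    rw [neg_neg, zero_smul, add_zero] at h3
    refine h1.unique (h3.congr_of_eventuallyEq (Eventually.of_forall fun h => ?_))
    -- After translation of `s` by `h`, moving `y` to `y + h • v` only changes the lower endpoint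
    -- from 0 to `h`, whence the derivative `β y`.
    have h4 := intervalIntegral.integral_comp_add_left (a := 0) (b := l p - l y - h)
      (fun s => β (y + s • v)) h
    have h5 : l p - l (y + h • v) = l p - l y - h := by
      rw [map_add, map_smul, hl, smul_eq_mul]; ring
    rw [add_zero, add_sub_cancel] at h4
    change -∫ s in (0 : ℝ)..(l p - l (y + h • v)), β (y + h • v + s • v) =
      -∫ s in h..(l p - l y), β (y + s • v)
    rw [h5, ← h4]
    simp only [add_smul, add_assoc]

theorem ext_on_single {L L' : Space →L[ℝ] ℝ}
    (h : ∀ i, L (EuclideanSpace.single i 1) = L' (EuclideanSpace.single i 1)) : L = L' := by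
  refine ContinuousLinearMap.coe_injective
    ((EuclideanSpace.basisFun (Fin 3) ℝ).toBasis.ext fun i => ?_)
  simpa using h i

/-- A continuously differentiable covector field is, near a regular point of `θ`, of the form
`dφ + ψ dθ + γ dν`. -/
theorem exists_local_potentials {m : ℕ∞} {U : Set Space} (hU : IsOpen U)
    {α : Space → Space →L[ℝ] ℝ} (hα : ContDiffOn ℝ ((m : WithTop ℕ∞) + 1) α U) {θ : Space → ℝ}
    (hθ : ContDiffOn ℝ ((m : WithTop ℕ∞) + 2) θ U) {p : Space} (hp : p ∈ U)
    (hθp : fderiv ℝ θ p ≠ 0) :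
    ∃ S : Set Space, IsOpen S ∧ p ∈ S ∧ S ⊆ U ∧ ∃ φ ψ γ ν : Space → ℝ,
      ContDiffOn ℝ ((m : WithTop ℕ∞) + 1) φ S ∧ ContDiffOn ℝ m ψ S ∧ ContDiffOn ℝ m γ S ∧
      ContDiff ℝ ((m : WithTop ℕ∞) + 2) ν ∧
      ∀ X ∈ S, α X = fderiv ℝ φ X + ψ X • fderiv ℝ θ X + γ X • fderiv ℝ ν X ∧
        ∀ a b : ℝ, a • fderiv ℝ θ X + b • fderiv ℝ ν X = 0 → a = 0 ∧ b = 0 := by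
  set e : Fin 3 → Space := fun i => EuclideanSpace.single i 1 with he
  obtain ⟨i, hi⟩ : ∃ i, fderiv ℝ θ p (e i) ≠ 0 := by
    by_contra! h
    exact hθp (ext_on_single h)
  obtain ⟨j, k, hji, hki, hjk, hall⟩ : ∃ j k : Fin 3, j ≠ i ∧ k ≠ i ∧ j ≠ k ∧
      ∀ l, l = i ∨ l = j ∨ l = k := by
    have key : ∀ i : Fin 3, ∃ j k : Fin 3, j ≠ i ∧ k ≠ i ∧ j ≠ k ∧
      ∀ l, l = i ∨ l = j ∨ l = k := by decide
    exact key i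
  have hdθ : ContDiffOn ℝ ((m : WithTop ℕ∞) + 1) (fderiv ℝ θ) U :=
    hθ.fderiv_of_isOpen hU (by rw [Motion.add_two_eq])
  have hdθv : ∀ v, ContDiffOn ℝ ((m : WithTop ℕ∞) + 1) (fun X => fderiv ℝ θ X v) U :=
    fun v => hdθ.clm_apply contDiffOn_const
  set U1 : Set Space := {X ∈ U | fderiv ℝ θ X (e i) ≠ 0} with hU1
  have hU1U : U1 ⊆ U := fun X hX => hX.1
  have hU1o : IsOpen U1 := (hdθv (e i)).continuousOn.isOpen_inter_preimage hU isOpen_ne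
  -- This replaces the coordinate `X i` by `θ`, and is a local diffeomorphism where the `i`-th
  -- partial derivative of `θ` is nonzero.
  set Θ : Space → Space := fun X => X + (θ X - X i) • e i with hΘ
  set D : Space → Space →L[ℝ] Space := fun X => ContinuousLinearMap.id ℝ Space +
    (fderiv ℝ θ X - EuclideanSpace.proj i).smulRight (e i) with hD
  have hΘc : ContDiffOn ℝ ((m : WithTop ℕ∞) + 2) Θ U :=
    contDiffOn_id.add ((hθ.sub (by fun_prop)).smul contDiffOn_const)
  have hΘd : ∀ X ∈ U, HasFDerivAt Θ (D X) X := by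
    intro X hX
    have h1 : HasFDerivAt θ (fderiv ℝ θ X) X :=
      ((hθ.contDiffAt (hU.mem_nhds hX)).differentiableAt (by simp)).hasFDerivAt
    have h2 : HasFDerivAt (fun X : Space => X i) (EuclideanSpace.proj i : Space →L[ℝ] ℝ) X :=
      (EuclideanSpace.proj i : Space →L[ℝ] ℝ).hasFDerivAt
    exact (hasFDerivAt_id X).add ((h1.sub h2).smul_const (e i))
  have hDe : ∀ X ∈ U1, ∃ A : Space ≃L[ℝ] Space, (A : Space →L[ℝ] Space) = D X := by
    intro X hX
    have hinj : Function.Injective (D X).toLinearMap := by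
      refine (injective_iff_map_eq_zero _).2 fun v hv => ?_
      have h1 : v + (fderiv ℝ θ X v - v i) • e i = 0 := hv
      have h2 : v = (v i - fderiv ℝ θ X v) • e i := by
        rw [← sub_eq_zero, ← h1]; module
      have h3 : fderiv ℝ θ X v = 0 := by
        have := congrArg (fun w : Space => w i) h1
        simpa [he] using this
      rw [h2, map_smul, smul_eq_mul] at h3
      rw [h2, (mul_eq_zero.1 h3).resolve_right hX.2, zero_smul]
    exact ⟨(LinearEquiv.ofInjectiveEndo (D X).toLinearMap hinj).toContinuousLinearEquiv,
      ContinuousLinearMap.ext fun _ => rfl⟩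
  have hpU1 : p ∈ U1 := ⟨hp, hi⟩
  obtain ⟨A, hA⟩ := hDe p hpU1
  have hcp := hΘc.contDiffAt (hU.mem_nhds hp)
  have hAp : HasFDerivAt Θ (A : Space →L[ℝ] Space) p := hA ▸ hΘd p hp
  set H := hcp.toOpenPartialHomeomorph Θ hAp (by simp) with hH
  have hHΘ : ∀ X, H X = Θ X := fun X => rfl
  have hps : p ∈ H.source := hcp.mem_toOpenPartialHomeomorph_source hAp (by simp)
  set V : Set Space := H.target ∩ H.symm ⁻¹' U1 with hV
  have hVo : IsOpen V := H.isOpen_inter_preimage_symm hU1o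
  have hG : ContDiffOn ℝ ((m : WithTop ℕ∞) + 2) H.symm V := by
    intro y hy
    obtain ⟨A', hA'⟩ := hDe _ hy.2
    refine (H.contDiffAt_symm (f₀' := A') hy.1 ?_ ?_).contDiffWithinAt
    · exact hA' ▸ hΘd _ (hU1U hy.2)
    · exact hΘc.contDiffAt (hU.mem_nhds (hU1U hy.2))
  -- The direction tangent to the level sets of both `θ` and `ν = X j`. A covector vanishing on `w`
  -- is a combination of `dθ` and `dν`, so `φ` need only satisfy `dφ(w) = α(w)`. The map `Θ` sends
  -- `w` to the constant vector `e k`, which reduces this to `exists_primitive_along`.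
  set w : Space → Space := fun X => e k - (fderiv ℝ θ X (e k) / fderiv ℝ θ X (e i)) • e i with hw
  have hwc : ContDiffOn ℝ ((m : WithTop ℕ∞) + 1) w U1 :=
    contDiffOn_const.sub ((((hdθv (e k)).mono hU1U).div ((hdθv (e i)).mono hU1U)
      fun X hX => hX.2).smul contDiffOn_const)
  have hθw : ∀ X ∈ U1, fderiv ℝ θ X (w X) = 0 := by
    intro X hX
    have := hX.2
    simp only [hw, map_sub, map_smul, smul_eq_mul]
    field_simp
    ring
  have hDw : ∀ X ∈ U1, D X (w X) = e k := by
    intro X hX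
    have h1 : D X (w X) = w X + (fderiv ℝ θ X (w X) - w X i) • e i := rfl
    rw [h1, hθw X hX]
    have h2 : w X i = -(fderiv ℝ θ X (e k) / fderiv ℝ θ X (e i)) := by
      simp [hw, he, hki.symm]
    rw [h2]
    simp only [hw]
    module
  have hβ : ContDiffOn ℝ ((m + 1 : ℕ∞) : WithTop ℕ∞)
      (fun y => α (H.symm y) (w (H.symm y))) V := by
    push_cast
    exact ((hα.mono hU1U).clm_apply hwc).comp (hG.of_le (Motion.add_one_le_add_two m))
      fun y hy => hy.2
  have hpV : Θ p ∈ V := ⟨H.map_source hps, by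
    rw [mem_preimage, ← hHΘ, H.left_inv hps]; exact hpU1⟩
  obtain ⟨B, hBo, hpB, -, φ', hφ', hφ'd⟩ := exists_primitive_along (n := m + 1) le_add_self hVo hβ
    hpV (v := e k) (l := (EuclideanSpace.proj k : Space →L[ℝ] ℝ)) (by simp [he])
  push_cast at hφ'
  set S : Set Space := (H.source ∩ H ⁻¹' B) ∩ U1 with hS
  have hSo : IsOpen S := (H.isOpen_inter_preimage hBo).inter hU1o
  have hSU : S ⊆ U := fun X hX => hU1U hX.2
  have hφ : ContDiffOn ℝ ((m : WithTop ℕ∞) + 1) (fun X => φ' (Θ X)) S :=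
    hφ'.comp ((hΘc.mono hSU).of_le (Motion.add_one_le_add_two m)) fun X hX => hX.1.2
  have hdφ : ContDiffOn ℝ m (fderiv ℝ (fun X => φ' (Θ X))) S := hφ.fderiv_of_isOpen hSo le_rfl
  have hb : ∀ v, ContDiffOn ℝ m (fun X => α X v - fderiv ℝ (fun X => φ' (Θ X)) X v) S := fun v =>
    (((hα.mono hSU).of_le le_self_add).clm_apply contDiffOn_const).sub
      (hdφ.clm_apply contDiffOn_const)
  have hθS : ∀ v, ContDiffOn ℝ m (fun X => fderiv ℝ θ X v) S := fun v =>
    ((hdθv v).mono hSU).of_le le_self_add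
  have hψ : ContDiffOn ℝ m (fun X => (α X (e i) - fderiv ℝ (fun X => φ' (Θ X)) X (e i)) /
      fderiv ℝ θ X (e i)) S := (hb (e i)).div (hθS (e i)) fun X hX => hX.2.2
  -- The coefficient `ψ` is read off on `e i`, where `dν` vanishes, then `γ` on `e j`. Both involve
  -- `dφ`, hence the loss of one derivative.
  refine ⟨S, hSo, ⟨⟨hps, hpB⟩, hpU1⟩, hSU, fun X => φ' (Θ X),
    fun X => (α X (e i) - fderiv ℝ (fun X => φ' (Θ X)) X (e i)) / fderiv ℝ θ X (e i),
    fun X => (α X (e j) - fderiv ℝ (fun X => φ' (Θ X)) X (e j)) -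
      (α X (e i) - fderiv ℝ (fun X => φ' (Θ X)) X (e i)) / fderiv ℝ θ X (e i) *
        fderiv ℝ θ X (e j),
    fun X => X j, hφ, hψ, (hb (e j)).sub (hψ.mul (hθS (e j))), by fun_prop, fun X hX => ?_⟩
  have hν : fderiv ℝ (fun X : Space => X j) X = (EuclideanSpace.proj j : Space →L[ℝ] ℝ) :=
    (EuclideanSpace.proj j : Space →L[ℝ] ℝ).fderiv
  have hθi := hX.2.2
  have hji' : (e i) j = 0 := by simp [he, hji]
  have hjj' : (e j) j = 1 := by simp [he]
  have hjk' : (e k) j = 0 := by simp [he, hjk]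
  rw [hν]
  constructor
  · have hbw : fderiv ℝ (fun X => φ' (Θ X)) X (w X) = α X (w X) := by
      have hφ'X : DifferentiableAt ℝ φ' (Θ X) :=
        (hφ'.contDiffAt (hBo.mem_nhds hX.1.2)).differentiableAt (by simp)
      have h1 : HasFDerivAt (fun X => φ' (Θ X)) ((fderiv ℝ φ' (Θ X)).comp (D X)) X :=
        hφ'X.hasFDerivAt.comp X (hΘd X (hSU hX))
      rw [h1.fderiv, ContinuousLinearMap.comp_apply, hDw X hX.2, hφ'd (Θ X) hX.1.2,
        show H.symm (Θ X) = X from H.left_inv hX.1.1]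
    simp only [hw, map_sub, map_smul, smul_eq_mul] at hbw
    refine ext_on_single fun l => ?_
    change α X (e l) = fderiv ℝ (fun X => φ' (Θ X)) X (e l) + _ * fderiv ℝ θ X (e l) +
      _ * (e l) j
    -- On `e i` and `e j` the identity holds by the choice of `ψ` and `γ`; on `e k` it is the
    -- equation `dφ(w) = α(w)`.
    rcases hall l with rfl | rfl | rfl
    · rw [hji']; field_simp; ring
    · rw [hjj']; ring
    · rw [hjk']
      have : α X (e l) = fderiv ℝ (fun X => φ' (Θ X)) X (e l) +
        (fderiv ℝ θ X (e l) / fderiv ℝ θ X (e i)) *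
          (α X (e i) - fderiv ℝ (fun X => φ' (Θ X)) X (e i)) := by linarith
      rw [this]
      ring
  · intro a b hab
    have h1 : a * fderiv ℝ θ X (e i) + b * (e i) j = 0 := DFunLike.congr_fun hab (e i)
    have h2 : a * fderiv ℝ θ X (e j) + b * (e j) j = 0 := DFunLike.congr_fun hab (e j)
    rw [hji', mul_zero, add_zero] at h1
    have ha := (mul_eq_zero.1 h1).resolve_right hθi
    rw [ha, hjj'] at h2
    exact ⟨ha, by linarith⟩

end LocalPotentials

/-! ### Transport of the rotational and conservation of mass. -/

namespace Fluid

open Set Filter Topology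

/-- The axial vector of the antisymmetric part of a bilinear form. -/
noncomputable def axialVector (B : Space →L[ℝ] Space →L[ℝ] ℝ) : Space :=
  !₂[B (EuclideanSpace.single 1 1) (EuclideanSpace.single 2 1) -
      B (EuclideanSpace.single 2 1) (EuclideanSpace.single 1 1),
    B (EuclideanSpace.single 2 1) (EuclideanSpace.single 0 1) -
      B (EuclideanSpace.single 0 1) (EuclideanSpace.single 2 1),
    B (EuclideanSpace.single 0 1) (EuclideanSpace.single 1 1) -
      B (EuclideanSpace.single 1 1) (EuclideanSpace.single 0 1)]

theorem rot_eq_axialVector (A : Space → Space) (x : Space) :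
    rot A x = axialVector ((innerSL ℝ).comp (fderiv ℝ A x)) := by
  simp [rot, axialVector, partialD, EuclideanSpace.inner_single_right]

theorem eq_sum_single (v : Space) : v = v 0 • EuclideanSpace.single 0 1 +
    v 1 • EuclideanSpace.single 1 1 + v 2 • EuclideanSpace.single 2 1 := by
  ext i; fin_cases i <;> simp

theorem det_eq_entries (F : Space →L[ℝ] Space) :
    LinearMap.det (F : Space →ₗ[ℝ] Space) =
      (Matrix.of fun i j => F (EuclideanSpace.single j 1) i).det := by
  rw [← LinearMap.det_toMatrix (EuclideanSpace.basisFun (Fin 3) ℝ).toBasis]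
  congr 1

theorem trace_eq_entries (F : Space →L[ℝ] Space) :
    LinearMap.trace ℝ Space (F : Space →ₗ[ℝ] Space) =
      F (EuclideanSpace.single 0 1) 0 + F (EuclideanSpace.single 1 1) 1 +
        F (EuclideanSpace.single 2 1) 2 := by
  rw [LinearMap.trace_eq_matrix_trace ℝ (EuclideanSpace.basisFun (Fin 3) ℝ).toBasis,
    Matrix.trace_fin_three]
  simp [LinearMap.toMatrix_apply]

/-- In dimension three a two-form is the volume form contracted with its axial vector, and `F` pulls
the volume form back to `det F` times itself. The identity is polynomial in the entries, so `F` may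
be singular. -/
theorem map_axialVector_of_pullback {F : Space →L[ℝ] Space} {B B' : Space →L[ℝ] Space →L[ℝ] ℝ}
    (h : ∀ a b, B' a b - B' b a = B (F a) (F b) - B (F b) (F a)) :
    F (axialVector B') = LinearMap.det (F : Space →ₗ[ℝ] Space) • axialVector B := by
  have hB : ∀ v w : Space, B v w =
      v 0 * w 0 * B (EuclideanSpace.single 0 1) (EuclideanSpace.single 0 1) +
      v 0 * w 1 * B (EuclideanSpace.single 0 1) (EuclideanSpace.single 1 1) +
      v 0 * w 2 * B (EuclideanSpace.single 0 1) (EuclideanSpace.single 2 1) +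
      v 1 * w 0 * B (EuclideanSpace.single 1 1) (EuclideanSpace.single 0 1) +
      v 1 * w 1 * B (EuclideanSpace.single 1 1) (EuclideanSpace.single 1 1) +
      v 1 * w 2 * B (EuclideanSpace.single 1 1) (EuclideanSpace.single 2 1) +
      v 2 * w 0 * B (EuclideanSpace.single 2 1) (EuclideanSpace.single 0 1) +
      v 2 * w 1 * B (EuclideanSpace.single 2 1) (EuclideanSpace.single 1 1) +
      v 2 * w 2 * B (EuclideanSpace.single 2 1) (EuclideanSpace.single 2 1) := by
    intro v w
    conv_lhs => rw [eq_sum_single v, eq_sum_single w]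
    simp only [map_add, map_smul, add_apply, smul_apply,
      smul_eq_mul]
    ring
  have hF : ∀ (v : Space) i, F v i = v 0 * F (EuclideanSpace.single 0 1) i +
      v 1 * F (EuclideanSpace.single 1 1) i + v 2 * F (EuclideanSpace.single 2 1) i := by
    intro v i
    conv_lhs => rw [eq_sum_single v]
    simp only [map_add, map_smul, PiLp.add_apply, PiLp.smul_apply, smul_eq_mul]
  have hBF : ∀ a b : Space, B (F a) (F b) = _ := fun a b => hB (F a) (F b)
  rw [det_eq_entries, Matrix.det_fin_three]
  ext i
  rw [hF, PiLp.smul_apply, smul_eq_mul]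
  simp only [axialVector, h, hBF, Matrix.of_apply]
  fin_cases i <;> simp <;> ring

/-- Liouville's formula. For the deformation gradient, `L` is the velocity gradient and its trace is
the divergence in the equation of continuity. -/
theorem hasDerivAt_det {F : ℝ → Space →L[ℝ] Space} {L : Space →L[ℝ] Space} {t : ℝ}
    (hF : HasDerivAt F (L.comp (F t)) t) :
    HasDerivAt (fun τ => LinearMap.det (F τ : Space →ₗ[ℝ] Space))
      (LinearMap.trace ℝ Space (L : Space →ₗ[ℝ] Space) *
        LinearMap.det (F t : Space →ₗ[ℝ] Space)) t := by
  have he : ∀ j i, HasDerivAt (fun τ => F τ (EuclideanSpace.single j 1) i)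
      (F t (EuclideanSpace.single j 1) 0 * L (EuclideanSpace.single 0 1) i +
       F t (EuclideanSpace.single j 1) 1 * L (EuclideanSpace.single 1 1) i +
       F t (EuclideanSpace.single j 1) 2 * L (EuclideanSpace.single 2 1) i) t := by
    intro j i
    have h1 := hF.clm_apply (hasDerivAt_const t (EuclideanSpace.single j (1 : ℝ)))
    have h2 := (EuclideanSpace.proj i : Space →L[ℝ] ℝ).hasFDerivAt.comp_hasDerivAt t h1
    refine h2.congr_deriv ?_
    simp only [ContinuousLinearMap.comp_apply, map_zero, add_zero]
    rw [eq_sum_single (F t (EuclideanSpace.single j 1))]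
    simp
  simp only [det_eq_entries, trace_eq_entries, Matrix.det_fin_three, Matrix.of_apply]
  have key := ((((((he 0 0).mul (he 1 1)).mul (he 2 2)).sub
    (((he 0 0).mul (he 2 1)).mul (he 1 2))).sub (((he 1 0).mul (he 0 1)).mul (he 2 2))).add
    (((he 2 0).mul (he 0 1)).mul (he 1 2))).add (((he 1 0).mul (he 2 1)).mul (he 0 2)) |>.sub
    (((he 2 0).mul (he 1 1)).mul (he 0 2))
  refine (key.congr_of_eventuallyEq (Eventually.of_forall fun τ => ?_)).congr_deriv ?_
  all_goals
    simp only [Pi.mul_apply, Pi.add_apply, Pi.sub_apply]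
    ring

namespace Motion

variable {m : ℕ∞} {M : Motion m}

theorem isOfClass_velocity : M.IsOfClass M.ref ((m : WithTop ℕ∞) + 1) M.velocity :=
  isOfClass_comp_label (f := M.refVelocity) (add_one_le_add_two m) le_rfl contDiffOn_refVelocity

theorem fderiv_velocity_comp_defGrad {t : ℝ} (ht : t ∈ M.time) {X : Space} (hX : X ∈ M.ref) :
    (fderiv ℝ (M.velocity t) (M.pos t X)).comp (M.defGrad t X) =
      fderiv ℝ (M.refVelocity t) X := by
  have h : M.refVelocity t =ᶠ[𝓝 X] fun Y => M.velocity t (M.pos t Y) := by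
    filter_upwards [M.isOpen_ref.mem_nhds hX] with Y hY using (velocity_pos ht hY).symm
  rw [h.fderiv_eq]
  exact ((isOfClass_velocity.differentiableAt le_add_self M.isOpen_ref le_rfl ht
    hX).hasFDerivAt.comp X (hasFDerivAt_pos ht hX)).fderiv.symm

theorem hasDerivAt_defGrad' {t : ℝ} (ht : t ∈ M.time) {X : Space} (hX : X ∈ M.ref) :
    HasDerivAt (fun τ => M.defGrad τ X)
      ((fderiv ℝ (M.velocity t) (M.pos t X)).comp (M.defGrad t X)) t :=
  fderiv_velocity_comp_defGrad ht hX ▸ hasDerivAt_defGrad ht hX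

theorem det_defGrad_ne_zero {t : ℝ} (ht : t ∈ M.time) {X : Space} (hX : X ∈ M.ref) :
    LinearMap.det (M.defGrad t X : Space →ₗ[ℝ] Space) ≠ 0 := by
  obtain ⟨e, he⟩ := exists_defGrad_eq ht hX
  rw [← he]
  exact e.toLinearEquiv.isUnit_det'.ne_zero

/-- Conservation of mass. -/
theorem Continuity.mul_det_eq {ρ : ℝ → Space → ℝ} (h : M.Continuity M.ref ρ) {s t : ℝ}
    (hs : s ∈ M.time) (ht : t ∈ M.time) {X : Space} (hX : X ∈ M.ref) :
    ρ s (M.pos s X) * LinearMap.det (M.defGrad s X : Space →ₗ[ℝ] Space) =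
      ρ t (M.pos t X) * LinearMap.det (M.defGrad t X : Space →ₗ[ℝ] Space) := by
  refine eq_of_hasDerivAt_zero (f := fun τ => ρ τ (M.pos τ X) *
    LinearMap.det (M.defGrad τ X : Space →ₗ[ℝ] Space)) M.isOpen_time M.ordConnected_time
    (fun τ hτ => ?_) hs ht
  refine ((h τ hτ X hX).mul (hasDerivAt_det (hasDerivAt_defGrad' hτ hX))).congr_deriv ?_
  simp only [div]
  ring

/-- The rotational of the transported covector is transported like a vector density. -/
theorem defGrad_axialVector_fderiv {t : ℝ} (ht : t ∈ M.time) {X : Space} (hX : X ∈ M.ref)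
    {c : Space → Space} (hc : DifferentiableAt ℝ c (M.pos t X)) :
    M.defGrad t X (axialVector
      (fderiv ℝ (fun Y => (innerSL ℝ (c (M.pos t Y))).comp (M.defGrad t Y)) X)) =
    LinearMap.det (M.defGrad t X : Space →ₗ[ℝ] Space) • rot c (M.pos t X) := by
  rw [rot_eq_axialVector]
  refine map_axialVector_of_pullback fun a b => ?_
  have hp : ContDiffAt ℝ ((m : WithTop ℕ∞) + 2) (M.pos t) X :=
    (contDiffAt_pos ht hX).comp X (f := fun Y : Space => (t, Y)) (by fun_prop)
  -- Differentiating `c* F` also produces a term with the second derivative of `pos t`; being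
  -- symmetric, it drops out of the antisymmetric part, leaving the pullback.
  have hsymm : IsSymmSndFDerivAt ℝ (M.pos t) X :=
    hp.isSymmSndFDerivAt (by simp)
  have hF : HasFDerivAt (M.defGrad t) (fderiv ℝ (M.defGrad t) X) X :=
    ((hp.fderiv_right (m := 1) (by rw [one_add_one_eq_two]; exact le_add_self)).differentiableAt
      (by simp)).hasFDerivAt
  have hcd := hc.hasFDerivAt.comp X (hasFDerivAt_pos ht hX)
  have h1 := ((innerSL ℝ (E := Space)).hasFDerivAt.comp X hcd).clm_comp hF
  have h2 : ∀ a b, fderiv ℝ (fun Y => (innerSL ℝ (c (M.pos t Y))).comp (M.defGrad t Y)) X a b =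
      inner ℝ (c (M.pos t X)) (fderiv ℝ (M.defGrad t) X a b) +
      inner ℝ (fderiv ℝ c (M.pos t X) (M.defGrad t X a)) (M.defGrad t X b) := fun a b => by
    have h3 := h1.fderiv
    have h4 := DFunLike.congr_fun (DFunLike.congr_fun h3 a) b
    exact h4
  have h5 : fderiv ℝ (M.defGrad t) X a b = fderiv ℝ (M.defGrad t) X b a := hsymm a b
  rw [h2, h2, h5]
  simp

theorem inverse_defGrad_apply {t : ℝ} (ht : t ∈ M.time) {X : Space} (hX : X ∈ M.ref) (v : Space) :
    (M.defGrad t X).inverse (M.defGrad t X v) = v := by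
  obtain ⟨e, he⟩ := exists_defGrad_eq ht hX
  rw [← he, ContinuousLinearMap.inverse_equiv]
  exact e.symm_apply_apply v

/-- Along each trajectory, `(1/ρ) rot C` is the image by the deformation gradient of a fixed
vector of the reference space. -/
theorem exists_rot_eq_defGrad {ρ : ℝ → Space → ℝ} {C : ℝ → Space → Space}
    (hρ : ∀ t ∈ M.time, ∀ x ∈ M.pos t '' M.ref, 0 < ρ t x) (hcont : M.Continuity M.ref ρ)
    (hC : M.IsOfClass M.ref 1 C)
    (hconv : M.HasConvectiveDerivCovector M.ref (fun t x => innerSL ℝ (C t x)) fun _ _ => 0)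
    {t : ℝ} (ht : t ∈ M.time) {X : Space} (hX : X ∈ M.ref) :
    ∃ k : Space, ∀ τ ∈ M.time,
      (1 / ρ τ (M.pos τ X)) • rot (C τ) (M.pos τ X) = M.defGrad τ X k := by
  set K : ℝ → Space → Space →L[ℝ] ℝ :=
    fun τ Y => (innerSL ℝ (C τ (M.pos τ Y))).comp (M.defGrad τ Y) with hK
  -- The rotational of the transported covector, divided by the conserved mass density of the
  -- reference space: neither depends on `t`.
  refine ⟨(1 / (ρ t (M.pos t X) * LinearMap.det (M.defGrad t X : Space →ₗ[ℝ] Space))) •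
    axialVector (fderiv ℝ (K t) X), fun τ hτ => ?_⟩
  -- Equality on a whole neighbourhood gives equality of the space derivatives, with no need to
  -- differentiate `rot C` in time.
  have h1 : K t =ᶠ[𝓝 X] K τ := by
    filter_upwards [M.isOpen_ref.mem_nhds hX] with Y hY
    refine eq_of_hasDerivAt_zero (f := fun τ => K τ Y) M.isOpen_time M.ordConnected_time
      (fun s hs => ?_) ht hτ
    exact (hconv s hs Y hY).congr_deriv (ContinuousLinearMap.zero_comp _)
  have hρ0 := (hρ τ hτ _ (mem_image_of_mem _ hX)).ne'
  have hd0 := det_defGrad_ne_zero hτ hX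
  rw [h1.fderiv_eq, hcont.mul_det_eq ht hτ hX, map_smul, defGrad_axialVector_fderiv hτ hX
    (hC.differentiableAt le_rfl M.isOpen_ref le_rfl hτ hX), smul_smul]
  congr 1
  field_simp

/-- `(1/ρ) rot C` is convected by the flow if the covector of `C` is. -/
theorem convected_rot {ρ : ℝ → Space → ℝ} {C : ℝ → Space → Space}
    (hρ : ∀ t ∈ M.time, ∀ x ∈ M.pos t '' M.ref, 0 < ρ t x) (hcont : M.Continuity M.ref ρ)
    (hC : M.IsOfClass M.ref 1 C)
    (hconv : M.HasConvectiveDerivCovector M.ref (fun t x => innerSL ℝ (C t x)) fun _ _ => 0) :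
    M.HasConvectiveDerivVector M.ref (fun t x => (1 / ρ t x) • rot (C t) x) (fun _ _ => 0) ∧
      M.HasMaterialDeriv M.ref (fun t x => (1 / ρ t x) • rot (C t) x)
        (fun t x => fderiv ℝ (M.velocity t) x ((1 / ρ t x) • rot (C t) x)) := by
  constructor
  · intro t ht X hX
    obtain ⟨k, hk⟩ := exists_rot_eq_defGrad hρ hcont hC hconv ht hX
    rw [map_zero]
    refine (hasDerivAt_const t k).congr_of_eventuallyEq ?_
    filter_upwards [eventually_mem_time ht] with τ hτ
    rw [hk τ hτ, inverse_defGrad_apply hτ hX]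
  · intro t ht X hX
    obtain ⟨k, hk⟩ := exists_rot_eq_defGrad hρ hcont hC hconv ht hX
    have h := (hasDerivAt_defGrad' ht hX).clm_apply (hasDerivAt_const t k)
    refine (h.congr_of_eventuallyEq ?_).congr_deriv ?_
    · filter_upwards [eventually_mem_time ht] with τ hτ using hk τ hτ
    · beta_reduce
      rw [hk t ht]
      simp

end Motion

end Fluid

/-! ### Construction of the global and local potentials. -/

namespace Fluid

open Set Filter Topology

/-- The vector associated with a covector. -/
noncomputable def sharp (L : Space →L[ℝ] ℝ) : Space :=
  ∑ i, L (EuclideanSpace.single i 1) • EuclideanSpace.single i 1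

theorem innerSL_sharp (L : Space →L[ℝ] ℝ) : innerSL ℝ (sharp L) = L := by
  refine ext_on_single fun i => ?_
  fin_cases i <;> simp [sharp, Fin.sum_univ_three, EuclideanSpace.inner_single_right]

theorem contDiff_sharp {n : WithTop ℕ∞} : ContDiff ℝ n sharp :=
  ContDiff.sum fun _ _ => (ContDiff.clm_apply contDiff_id contDiff_const).smul contDiff_const

namespace Motion

variable {m : ℕ∞} {M : Motion m} {S : Set Space}

theorem innerSL_velocity_comp_defGrad {t : ℝ} (ht : t ∈ M.time) {X : Space} (hX : X ∈ M.ref) :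
    (innerSL ℝ (M.velocity t (M.pos t X))).comp (M.defGrad t X) = M.momentum t X := by
  rw [velocity_pos ht hX, momentum]

theorem fderiv_comp_label_pos (hS : IsOpen S) (hSr : S ⊆ M.ref) (Φ : Space → ℝ) {t : ℝ}
    (ht : t ∈ M.time) {X : Space} (hX : X ∈ S) :
    fderiv ℝ (fun Y => Φ (M.label t (M.pos t Y))) X = fderiv ℝ Φ X := by
  refine Filter.EventuallyEq.fderiv_eq ?_
  filter_upwards [hS.mem_nhds hX] with Y hY
  rw [label_pos ht (hSr hY)]

theorem innerSL_gradient_comp_label (hS : IsOpen S) (hSr : S ⊆ M.ref) {Φ : ℝ → Space → ℝ}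
    (hΦ : M.IsOfClass S 1 fun t x => Φ t (M.label t x)) {t : ℝ} (ht : t ∈ M.time) {X : Space}
    (hX : X ∈ S) :
    (innerSL ℝ (gradient (fun x => Φ t (M.label t x)) (M.pos t X))).comp (M.defGrad t X) =
      fderiv ℝ (Φ t) X := by
  rw [innerSL_gradient_comp_defGrad ht (hSr hX) (hΦ.differentiableAt le_rfl hS hSr ht hX),
    fderiv_comp_label_pos hS hSr (Φ t) ht hX]

theorem hasMaterialDeriv_comp_label (hSr : S ⊆ M.ref) {Φ h : ℝ → Space → ℝ}
    (hΦ : ∀ t ∈ M.time, ∀ X ∈ S, HasDerivAt (fun τ => Φ τ X) (h t (M.pos t X)) t) :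
    M.HasMaterialDeriv S (fun t x => Φ t (M.label t x)) h := by
  intro t ht X hX
  refine (hΦ t ht X hX).congr_of_eventuallyEq ?_
  filter_upwards [eventually_mem_time ht] with τ hτ
  rw [label_pos hτ (hSr hX)]

theorem refLagrangian_eq (g Ω : ℝ → Space → ℝ) {t : ℝ} (ht : t ∈ M.time) {X : Space}
    (hX : X ∈ M.ref) : M.refLagrangian g Ω t X =
      (1 / 2) * ‖M.velocity t (M.pos t X)‖ ^ 2 - g t (M.pos t X) - Ω t (M.pos t X) := by
  rw [velocity_pos ht hX, refLagrangian]

theorem contDiffOn_momentum (a : ℝ) (ha : a ∈ M.time) :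
    ContDiffOn ℝ ((m : WithTop ℕ∞) + 1) (M.momentum a) M.ref := by
  have h : ContDiffOn ℝ ((m : WithTop ℕ∞) + 1) (fun X : Space => (a, X)) M.ref := by fun_prop
  have hm : MapsTo (fun X : Space => (a, X)) M.ref (M.time ×ˢ M.ref) := fun X hX => ⟨ha, hX⟩
  exact ((innerSL ℝ (E := Space)).contDiff.comp_contDiffOn
    (contDiffOn_refVelocity.comp h hm)).clm_comp (contDiffOn_defGrad.comp h hm)

/-- The action potential and the thermal potential which vanish at the time `a`. -/
theorem FlowSystem.exists_ref_potentials {ρ T g Ω u : ℝ → Space → ℝ}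
    (hT : M.IsOfClass M.ref ((m : WithTop ℕ∞) + 2) T)
    (hg : M.IsOfClass M.ref ((m : WithTop ℕ∞) + 1) g)
    (hΩ : M.IsOfClass M.ref ((m : WithTop ℕ∞) + 1) Ω)
    (hu : M.IsOfClass M.ref ((m : WithTop ℕ∞) + 1) u)
    (h : M.FlowSystem M.ref ρ T g Ω u) {a : ℝ} (ha : a ∈ M.time) :
    ∃ Φ Ψ : ℝ → Space → ℝ,
      ContDiffOn ℝ ((m : WithTop ℕ∞) + 1) (fun q : ℝ × Space => Φ q.1 q.2) (M.time ×ˢ M.ref) ∧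
      ContDiffOn ℝ ((m : WithTop ℕ∞) + 1) (fun q : ℝ × Space => Ψ q.1 q.2) (M.time ×ˢ M.ref) ∧
      (∀ t ∈ M.time, ∀ X ∈ M.ref, HasDerivAt (fun τ => Φ τ X)
        ((1 / 2) * ‖M.velocity t (M.pos t X)‖ ^ 2 - g t (M.pos t X) - Ω t (M.pos t X)) t) ∧
      (∀ t ∈ M.time, ∀ X ∈ M.ref, HasDerivAt (fun τ => Ψ τ X) (u t (M.pos t X)) t) ∧
      ∀ t ∈ M.time, ∀ X ∈ M.ref, M.momentum t X = fderiv ℝ (Φ t) X +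
        Ψ t X • fderiv ℝ (fun Y => T t (M.pos t Y)) X + M.momentum a X := by
  have hL := contDiffOn_refLagrangian (M := M) le_rfl le_rfl hg hΩ
  have hU := hu.contDiffOn_comp_pos (add_one_le_add_two m) le_rfl
  have hprim : ∀ f : ℝ → Space → ℝ, ContDiffOn ℝ ((m : WithTop ℕ∞) + 1)
      (fun q : ℝ × Space => f q.1 q.2) (M.time ×ˢ M.ref) →
      ContDiffOn ℝ ((m : WithTop ℕ∞) + 1) (fun q : ℝ × Space => ∫ s in a..q.1, f s q.2)
        (M.time ×ˢ M.ref) ∧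
      ∀ t ∈ M.time, ∀ X ∈ M.ref, HasDerivAt (fun τ => ∫ s in a..τ, f s X) (f t X) t := by
    intro f hf
    refine ⟨?_, fun t ht X hX => ?_⟩
    · have := contDiffOn_primitive (n := m + 1) M.isOpen_time M.ordConnected_time M.isOpen_ref
        (by push_cast; exact hf) ha
      push_cast at this
      exact this
    · exact hasDerivAt_primitive M.isOpen_time M.ordConnected_time (f := fun s => f s X)
        (continuousOn_fst_of_contDiffAt fun s hs =>
          hf.contDiffAt_prod M.isOpen_time M.isOpen_ref hs hX) ha ht
  obtain ⟨hΦ, hΦd⟩ := hprim _ hL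
  obtain ⟨hΨ, hΨd⟩ := hprim (fun t X => u t (M.pos t X)) hU
  refine ⟨_, _, hΦ, hΨ, fun t ht X hX => refLagrangian_eq g Ω ht hX ▸ hΦd t ht X hX, hΨd,
    fun t ht X hX => momentum_eq_of_motionEquation (hT.mono (one_le_add_two m) le_rfl)
      (hg.mono le_add_self le_rfl) (hΩ.mono le_add_self le_rfl) h.temperature h.motion ha
      (fun s hs Y hY => ?_) hΦd hΨd (by simp) (by simp) ht hX⟩
  exact ((hΦ.contDiffAt_prod M.isOpen_time M.isOpen_ref hs hY).differentiableAt (by simp)).comp Y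
    (f := fun Y : Space => (s, Y)) (by fun_prop)

theorem contDiffOn_inverse_defGrad :
    ContDiffOn ℝ ((m : WithTop ℕ∞) + 1) (fun q : ℝ × Space => (M.defGrad q.1 q.2).inverse)
      (M.time ×ˢ M.ref) := by
  intro q hq
  obtain ⟨e, he⟩ := exists_defGrad_eq hq.1 hq.2
  have h := contDiffAt_map_inverse (𝕜 := ℝ) (n := (m : WithTop ℕ∞) + 1) e
  rw [he] at h
  exact h.comp_contDiffWithinAt q (contDiffOn_defGrad q hq)

theorem inverse_comp_defGrad {t : ℝ} (ht : t ∈ M.time) {X : Space} (hX : X ∈ M.ref)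
    (L : Space →L[ℝ] ℝ) : (L.comp (M.defGrad t X).inverse).comp (M.defGrad t X) = L :=
  ContinuousLinearMap.ext fun v => by
    simp only [ContinuousLinearMap.comp_apply, inverse_defGrad_apply ht hX]

/-- The covector of `C` is the momentum at time `a` carried forward by the inverse deformation
gradient; its image in the reference space is constant by construction. -/
theorem FlowSystem.exists_potentialSystem {ρ T g Ω u : ℝ → Space → ℝ}
    (hT : M.IsOfClass M.ref ((m : WithTop ℕ∞) + 2) T)
    (hg : M.IsOfClass M.ref ((m : WithTop ℕ∞) + 1) g)
    (hΩ : M.IsOfClass M.ref ((m : WithTop ℕ∞) + 1) Ω)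
    (hu : M.IsOfClass M.ref ((m : WithTop ℕ∞) + 1) u)
    (h : M.FlowSystem M.ref ρ T g Ω u) {a : ℝ} (ha : a ∈ M.time) :
    ∃ (φ ψ : ℝ → Space → ℝ) (C : ℝ → Space → Space),
      M.IsOfClass M.ref ((m : WithTop ℕ∞) + 1) φ ∧ M.IsOfClass M.ref ((m : WithTop ℕ∞) + 1) ψ ∧
      M.IsOfClass M.ref ((m : WithTop ℕ∞) + 1) C ∧ M.PotentialSystem M.ref T g Ω u φ ψ C := by
  obtain ⟨Φ, Ψ, hΦ, hΨ, hΦd, hΨd, hmom⟩ := h.exists_ref_potentials hT hg hΩ hu ha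
  set c : ℝ → Space → Space := fun t X => sharp ((M.momentum a X).comp (M.defGrad t X).inverse)
    with hc
  have hφc := isOfClass_comp_label (add_one_le_add_two m) le_rfl hΦ
  have hcc : ∀ t ∈ M.time, ∀ X ∈ M.ref,
      (innerSL ℝ (c t (M.label t (M.pos t X)))).comp (M.defGrad t X) = M.momentum a X := by
    intro t ht X hX
    rw [label_pos ht hX, hc]
    beta_reduce
    rw [innerSL_sharp, inverse_comp_defGrad ht hX]
  refine ⟨fun t x => Φ t (M.label t x), fun t x => Ψ t (M.label t x),
    fun t x => c t (M.label t x), hφc, isOfClass_comp_label (add_one_le_add_two m) le_rfl hΨ,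
    isOfClass_comp_label (add_one_le_add_two m) le_rfl ?_, ?_, h.temperature,
    hasMaterialDeriv_comp_label le_rfl hΦd, hasMaterialDeriv_comp_label le_rfl hΨd, ?_⟩
  · exact contDiff_sharp.comp_contDiffOn (((contDiffOn_momentum a ha).comp contDiffOn_snd
      fun q hq => hq.2).clm_comp contDiffOn_inverse_defGrad)
  · rintro t ht _ ⟨X, hX, rfl⟩
    rw [← innerSL_comp_defGrad_inj ht hX, innerSL_velocity_comp_defGrad ht hX, hmom t ht X hX]
    simp only [map_add, map_smul, ContinuousLinearMap.add_comp, ContinuousLinearMap.smul_comp]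
    rw [hcc t ht X hX, innerSL_gradient_comp_label M.isOpen_ref le_rfl
      (hφc.mono le_add_self le_rfl) ht hX, innerSL_gradient_comp_defGrad ht hX
      (hT.differentiableAt (one_le_add_two m) M.isOpen_ref le_rfl ht hX), label_pos ht hX]
  · intro t ht X hX
    rw [ContinuousLinearMap.zero_comp]
    refine (hasDerivAt_const t (M.momentum a X)).congr_of_eventuallyEq ?_
    filter_upwards [eventually_mem_time ht] with τ hτ using hcc τ hτ X hX

/-- Only the momentum at time `a` is decomposed, near `p`. Since `dθ` does not depend on time,
adding `φ₀` to `Φ` and `ψ₀` to `Ψ`, and letting `γ₀` and `ν₀` follow the particles, gives potentials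
valid for all times on the same `S`. Linear independence is likewise inherited from the reference
space. -/
theorem FlowSystem.exists_clebschSystem {ρ T g Ω u : ℝ → Space → ℝ}
    (hT : M.IsOfClass M.ref ((m : WithTop ℕ∞) + 2) T)
    (hg : M.IsOfClass M.ref ((m : WithTop ℕ∞) + 1) g)
    (hΩ : M.IsOfClass M.ref ((m : WithTop ℕ∞) + 1) Ω)
    (hu : M.IsOfClass M.ref ((m : WithTop ℕ∞) + 1) u)
    (h : M.FlowSystem M.ref ρ T g Ω u) {a : ℝ} (ha : a ∈ M.time) {p : Space} (hp : p ∈ M.ref)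
    (hTp : gradient (T a) (M.pos a p) ≠ 0) :
    ∃ S : Set Space, IsOpen S ∧ p ∈ S ∧ S ⊆ M.ref ∧
      ∃ φ ψ γ ν : ℝ → Space → ℝ,
        M.IsOfClass S ((m : WithTop ℕ∞) + 1) φ ∧ M.IsOfClass S (m : WithTop ℕ∞) ψ ∧
        M.IsOfClass S (m : WithTop ℕ∞) γ ∧ M.IsOfClass S ((m : WithTop ℕ∞) + 2) ν ∧
        M.ClebschSystem S T g Ω u φ ψ γ ν ∧
        ∀ t ∈ M.time, ∀ x ∈ M.pos t '' S,
          LinearIndependent ℝ ![gradient (T t) x, gradient (ν t) x] := by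
  obtain ⟨Φ, Ψ, hΦ, hΨ, hΦd, hΨd, hmom⟩ := h.exists_ref_potentials hT hg hΩ hu ha
  have hTd : ∀ t ∈ M.time, ∀ X ∈ M.ref, DifferentiableAt ℝ (T t) (M.pos t X) :=
    fun t ht X hX => hT.differentiableAt (one_le_add_two m) M.isOpen_ref le_rfl ht hX
  have hθ : ContDiffOn ℝ ((m : WithTop ℕ∞) + 2) (fun X => T a (M.pos a X)) M.ref :=
    (hT.contDiffOn_comp_pos le_rfl le_rfl).comp (f := fun X : Space => (a, X)) (by fun_prop)
      fun X hX => ⟨ha, hX⟩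
  have hθp : fderiv ℝ (fun X => T a (M.pos a X)) p ≠ 0 := by
    rw [← innerSL_gradient_comp_defGrad ha hp (hTd a ha p hp)]
    intro h0
    refine hTp ((innerSL_comp_defGrad_inj ha hp).1 ?_)
    rw [h0, map_zero, ContinuousLinearMap.zero_comp]
  have hTθ : ∀ t ∈ M.time, ∀ X ∈ M.ref, fderiv ℝ (fun Y => T t (M.pos t Y)) X =
      fderiv ℝ (fun Y => T a (M.pos a Y)) X := fun t ht X hX =>
    eq_of_hasDerivAt_zero (f := fun τ => fderiv ℝ (fun Y => T τ (M.pos τ Y)) X)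
      M.isOpen_time M.ordConnected_time
      (fun s hs => h.temperature.hasDerivAt_fderiv_of_zero M.isOpen_ref le_rfl
        (hT.mono (one_le_add_two m) le_rfl) hs hX) ht ha
  obtain ⟨S, hS, hpS, hSr, φ₀, ψ₀, γ₀, ν₀, hφ₀, hψ₀, hγ₀, hν₀, hdec⟩ :=
    exists_local_potentials M.isOpen_ref (contDiffOn_momentum a ha) hθ hp hθp
  have hsub : M.time ×ˢ S ⊆ M.time ×ˢ M.ref := prod_mono le_rfl hSr
  have hlift : ∀ {n : WithTop ℕ∞} {f : Space → ℝ}, ContDiffOn ℝ n f S →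
      ContDiffOn ℝ n (fun q : ℝ × Space => f q.2) (M.time ×ˢ S) :=
    fun hf => hf.comp contDiffOn_snd fun q hq => hq.2
  have hm2 : (m : WithTop ℕ∞) ≤ (m : WithTop ℕ∞) + 2 := le_self_add
  have hφ : M.IsOfClass S ((m : WithTop ℕ∞) + 1)
      (fun t x => Φ t (M.label t x) + φ₀ (M.label t x)) :=
    isOfClass_comp_label (f := fun t X => Φ t X + φ₀ X) (add_one_le_add_two m) hSr
      ((hΦ.mono hsub).add (hlift hφ₀))
  have hν : M.IsOfClass S ((m : WithTop ℕ∞) + 2) (fun t x => ν₀ (M.label t x)) :=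
    isOfClass_comp_label (f := fun _ X => ν₀ X) le_rfl hSr (hlift hν₀.contDiffOn)
  have hgν : ∀ t ∈ M.time, ∀ X ∈ S, (innerSL ℝ (gradient (fun x => ν₀ (M.label t x))
      (M.pos t X))).comp (M.defGrad t X) = fderiv ℝ ν₀ X := fun t ht X hX =>
    innerSL_gradient_comp_label (Φ := fun _ => ν₀) hS hSr (hν.mono (one_le_add_two m) le_rfl) ht hX
  have hgT : ∀ t ∈ M.time, ∀ X ∈ S, (innerSL ℝ (gradient (T t) (M.pos t X))).comp
      (M.defGrad t X) = fderiv ℝ (fun Y => T a (M.pos a Y)) X := fun t ht X hX => by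
    rw [innerSL_gradient_comp_defGrad ht (hSr hX) (hTd t ht X (hSr hX)), hTθ t ht X (hSr hX)]
  refine ⟨S, hS, hpS, hSr, fun t x => Φ t (M.label t x) + φ₀ (M.label t x),
    fun t x => Ψ t (M.label t x) + ψ₀ (M.label t x), fun t x => γ₀ (M.label t x),
    fun t x => ν₀ (M.label t x), hφ, ?_, ?_, hν, ⟨?_, ?_, ?_, ?_, ?_, ?_⟩, ?_⟩
  · exact isOfClass_comp_label (f := fun t X => Ψ t X + ψ₀ X) hm2 hSr
      (((hΨ.of_le le_self_add).mono hsub).add (hlift hψ₀))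
  · exact isOfClass_comp_label (f := fun _ X => γ₀ X) hm2 hSr (hlift hγ₀)
  · rintro t ht _ ⟨X, hX, rfl⟩
    have hΦX : DifferentiableAt ℝ (Φ t) X :=
      ((hΦ.contDiffAt_prod M.isOpen_time M.isOpen_ref ht (hSr hX)).differentiableAt
        (by simp)).comp X (f := fun Y : Space => (t, Y)) (by fun_prop)
    have hφ₀X : DifferentiableAt ℝ φ₀ X :=
      (hφ₀.contDiffAt (hS.mem_nhds hX)).differentiableAt (by simp)
    rw [← innerSL_comp_defGrad_inj ht (hSr hX), innerSL_velocity_comp_defGrad ht (hSr hX),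
      hmom t ht X (hSr hX), (hdec X hX).1, hTθ t ht X (hSr hX)]
    simp only [map_add, map_smul, ContinuousLinearMap.add_comp, ContinuousLinearMap.smul_comp]
    rw [hgν t ht X hX, hgT t ht X hX, label_pos ht (hSr hX),
      innerSL_gradient_comp_label (Φ := fun t X => Φ t X + φ₀ X) hS hSr
        (hφ.mono le_add_self le_rfl) ht hX, fderiv_fun_add hΦX hφ₀X]
    module
  · exact fun t ht X hX => h.temperature t ht X (hSr hX)
  · exact hasMaterialDeriv_comp_label (Φ := fun t X => Φ t X + φ₀ X) hSr
      fun t ht X hX => (hΦd t ht X (hSr hX)).add_const _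
  · exact hasMaterialDeriv_comp_label (Φ := fun t X => Ψ t X + ψ₀ X) hSr
      fun t ht X hX => (hΨd t ht X (hSr hX)).add_const _
  · exact hasMaterialDeriv_comp_label (Φ := fun _ X => γ₀ X) hSr
      fun t _ X _ => hasDerivAt_const t _
  · exact hasMaterialDeriv_comp_label (Φ := fun _ X => ν₀ X) hSr
      fun t _ X _ => hasDerivAt_const t _
  · rintro t ht _ ⟨X, hX, rfl⟩
    refine LinearIndependent.pair_iff.2 fun r s hrs => (hdec X hX).2 r s ?_
    rw [← hgν t ht X hX, ← hgT t ht X hX, ← ContinuousLinearMap.smul_comp,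
      ← ContinuousLinearMap.smul_comp, ← ContinuousLinearMap.add_comp, ← map_smul, ← map_smul,
      ← map_add, hrs, map_zero, ContinuousLinearMap.zero_comp]

end Motion

end Fluid

theorem mainTheorem3 (m : ℕ∞) (M : Fluid.Motion m) (ρ T g Ω u : ℝ → Fluid.Space → ℝ)
    (hρ : ∀ t ∈ M.time, ∀ x ∈ M.pos t '' M.ref, 0 < ρ t x)
    (hT : M.IsOfClass M.ref ((m : WithTop ℕ∞) + 2) T)
    (hg : M.IsOfClass M.ref ((m : WithTop ℕ∞) + 1) g)
    (hΩ : M.IsOfClass M.ref ((m : WithTop ℕ∞) + 1) Ω)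
    (hu : M.IsOfClass M.ref ((m : WithTop ℕ∞) + 1) u) :
    -- equivalence with the representation by means of a convected covector
    (M.FlowSystem M.ref ρ T g Ω u ↔
      M.Continuity M.ref ρ ∧
        ∃ (φ ψ : ℝ → Fluid.Space → ℝ) (C : ℝ → Fluid.Space → Fluid.Space),
          M.IsOfClass M.ref ((m : WithTop ℕ∞) + 1) φ ∧
          M.IsOfClass M.ref ((m : WithTop ℕ∞) + 1) ψ ∧
          M.IsOfClass M.ref ((m : WithTop ℕ∞) + 1) C ∧
          M.PotentialSystem M.ref T g Ω u φ ψ C) ∧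
    -- in that representation, `(1/ρ) rot C` is convected by the flow
    (M.Continuity M.ref ρ →
      ∀ (φ ψ : ℝ → Fluid.Space → ℝ) (C : ℝ → Fluid.Space → Fluid.Space),
        M.IsOfClass M.ref 1 C → M.PotentialSystem M.ref T g Ω u φ ψ C →
          M.HasConvectiveDerivVector M.ref
            (fun t x => (1 / ρ t x) • Fluid.rot (C t) x) (fun _ _ => 0) ∧
          M.HasMaterialDeriv M.ref
            (fun t x => (1 / ρ t x) • Fluid.rot (C t) x)
            (fun t x => fderiv ℝ (M.velocity t) x ((1 / ρ t x) • Fluid.rot (C t) x))) ∧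
    -- local representation by the five potentials near each particle where `grad T ≠ 0`
    (M.FlowSystem M.ref ρ T g Ω u →
      ∀ t₀ ∈ M.time, ∀ X₀ ∈ M.ref, gradient (T t₀) (M.pos t₀ X₀) ≠ 0 →
        ∃ S : Set Fluid.Space, IsOpen S ∧ X₀ ∈ S ∧ S ⊆ M.ref ∧
          ∃ φ ψ γ ν : ℝ → Fluid.Space → ℝ,
            M.IsOfClass S ((m : WithTop ℕ∞) + 1) φ ∧
            M.IsOfClass S (m : WithTop ℕ∞) ψ ∧
            M.IsOfClass S (m : WithTop ℕ∞) γ ∧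
            M.IsOfClass S ((m : WithTop ℕ∞) + 2) ν ∧
            M.ClebschSystem S T g Ω u φ ψ γ ν ∧
            ∀ t ∈ M.time, ∀ x ∈ M.pos t '' S,
              LinearIndependent ℝ ![gradient (T t) x, gradient (ν t) x]) ∧
    -- conversely, the potential equations imply the equations of the flow
    (M.Continuity M.ref ρ →
      (∀ X₀ ∈ M.ref, ∃ S : Set Fluid.Space, IsOpen S ∧ X₀ ∈ S ∧ S ⊆ M.ref ∧
        ∃ φ ψ γ ν : ℝ → Fluid.Space → ℝ,
          M.IsOfClass S 1 φ ∧ M.IsOfClass S 0 ψ ∧ M.IsOfClass S 0 γ ∧ M.IsOfClass S 1 ν ∧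
          M.ClebschSystem S T g Ω u φ ψ γ ν) →
      M.FlowSystem M.ref ρ T g Ω u) := by
  have hT1 := hT.mono (Fluid.Motion.one_le_add_two m) (le_refl M.ref)
  have hg1 : M.IsOfClass M.ref 1 g := hg.mono le_add_self le_rfl
  have hΩ1 : M.IsOfClass M.ref 1 Ω := hΩ.mono le_add_self le_rfl
  refine ⟨⟨fun h => ⟨h.continuity, ?_⟩, ?_⟩, ?_, ?_, ?_⟩
  -- A `Motion` may have an empty time interval, hence no initial time; zero fields then do
  -- vacuously.
  · rcases M.time.eq_empty_or_nonempty with hempty | ⟨a, ha⟩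
    · have hno : ∀ t, t ∉ M.time := fun t => by simp [hempty]
      refine ⟨fun _ _ => 0, fun _ _ => 0, fun _ _ => 0, contDiffOn_const, contDiffOn_const,
        contDiffOn_const, ?_, h.temperature, ?_, ?_, ?_⟩ <;> exact fun t ht => (hno t ht).elim
    · exact h.exists_potentialSystem hT hg hΩ hu ha
  · rintro ⟨hcont, φ, ψ, C, hφ, -, -, h⟩
    exact ⟨hcont, h.deriv_T, h.motionEquation M.isOpen_ref le_rfl hT1 hg1 hΩ1
      (hφ.mono le_add_self le_rfl)⟩
  · exact fun hcont φ ψ C hC h => Fluid.Motion.convected_rot hρ hcont hC h.convected_C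
  · exact fun h a ha p hp hTp => h.exists_clebschSystem hT hg hΩ hu ha hp hTp
  · intro hcont h
    refine ⟨hcont, fun t ht X hX => ?_, fun t ht X hX => ?_⟩
    · obtain ⟨S, -, hXS, -, φ, ψ, γ, ν, -, -, -, -, hE⟩ := h X hX
      exact hE.deriv_T t ht X hXS
    -- The equation of motion is a condition on each particle separately, so potentials defined
    -- around that particle suffice.
    · obtain ⟨S, hS, hXS, hSr, φ, ψ, γ, ν, hφ, -, -, hν, hE⟩ := h X hX
      exact (hE.potentialSystem hS hSr hν).motionEquation hS hSr (hT1.mono le_rfl hSr)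
        (hg1.mono le_rfl hSr) (hΩ1.mono le_rfl hSr) hφ t ht X hXS
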